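/- **Setting.** Let $G$ be a Coxeter diagram with finite vertex set, $A$ an integral (crystallographic) Cartan matrix for it, and $V$ the real vector space with basis the simple roots $\alpha_y$, $y$ a vertex of $G$. The simple reflections act by $s_y(\beta)=\beta-(\alpha_y,\beta)\alpha_y$, where $(\alpha_y,\alpha_z)=A_{yz}$. The root system $\Phi$ is the union of the orbits of the simple roots; roots are viewed as integer-valued functions on the vertices, and a root is positive if its values are nonnegative. A reduced expression $\alpha=s_{y_k}\cdots s_{y_1}(\alpha_{y_0})$ is one with $k$ minimal, and then $\operatorname{depth}(\alpha)=k+1$. For a root $\alpha$ let $\alpha^\perp=\{\varphi\in V^*:\varphi(\alpha)=0\}$, and let $D\subset V^*$ be the set of points pairing positively with all simple roots. For distinct hyperplanes $H_1,H_2$ of the arrangement $\{\alpha^\perp:\alpha\in\Phi\}$, the rank 2 subarrangement they generate consists of the hyperplanes of the arrangement containing $H_1\cap H_2$; its basic hyperplanes are the ones bounding its region that contains $D$. If $H_1$ is basic and $H_2$ is not, then $H_1$ cuts $H_2$ and the subspace $H_1\cap H_2$ is a fracture of $H_2$. Let $x$ be a vertex of $G$ and $L_x\sqcup R_x$ a partition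 of its neighbours (parts may be empty). The stretched diagram $\mathrm{st}_n(G)$ replaces $x$ by a path $x_0,\dots,x_n$ with $x_0$ joined to $L_x$ and $x_n$ to $R_x$. Its Cartan matrix $\mathrm{st}_n(A)$ agrees with $A$ off the path, the entries between $x_0$ and $L_x$ and between $x_n$ and $R_x$ being those of $A$ with $x$ in place of $x_0$, $x_n$; on the path it has $2$ on the diagonal and $-1$ for adjacent vertices; all other entries are $0$. It defines $\mathrm{st}_n(\Phi)$. For a function $\alpha$ on the vertices of $G$, $\mathrm{st}_n(\alpha)$ has value $\alpha(x)$ on the path and agrees with $\alpha$ elsewhere. In $\mathrm{st}_n(G)$ put $\beta_y=\alpha_y$ for $y$ off the path and $\beta_{x_i}=\sum_{j\le i}\alpha_{x_j}$. For a function $\gamma$ on the vertices of $G$ let $S_L(\gamma)=\sum_{y\in L_x}-A_{xy}\gamma(y)$ and $S_R(\gamma)=\sum_{y\in R_x}-A_{xy}\gamma(y)$. A type (1) expression for $\alpha$ is a reduced expression $s_{y_k}\cdots s_{y_1}(\alpha_{y_0})$ such that for every $i\ge 1$ with $y_i=x$ the root $\gamma=s_{y_i}\cdots s_{y_1}(\alpha_{y_0})$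 has one of $S_L(\gamma),S_R(\gamma)$ less than $\gamma(x)$ and the other equal to $\gamma(x)$. **Theorem.** Let $\alpha$ be a positive root of $\Phi$. There is an integer $t\ge 0$ (the depth growth rate of $\alpha$) with $\operatorname{depth}(\mathrm{st}_n(\alpha))=tn+\operatorname{depth}(\alpha)$ for all $n\ge 0$, and the following hold. 1. If $\alpha$ has a type (1) expression, then there exist integers $r,s\ge 0$ and formal real linear combinations $f_1,\dots,f_s$ and $g_1,\dots,g_t$, independent of $n$, of the symbols $\beta_y$ ($y\ne x$ a vertex of $G$), $\beta_{x_0},\dots,\beta_{x_r}$, $\beta_{x_{n-r}},\dots,\beta_{x_n}$, such that for every $n\ge 2r$ the fractures of $\mathrm{st}_n(\alpha)^\perp$ are precisely the intersections of $\mathrm{st}_n(\alpha)^\perp$ with the members of $$\{f_i^\perp : 1\le i\le s\}\cup\{(g_i-\beta_{x_j})^\perp : 1\le i\le t,\ r+1\le j\le n-r-1\}.$$ 2. Without assuming that $\alpha$ has a type (1) expression, there exist $r,s$ and such formal linear combinations $f_1,\dots,f_s,g_1,\dots,g_t$ (with the same $t$), independent of $n$, for which the same description of the fractures of $\mathrm{st}_n(\alpha)^\perp$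 holds for all sufficiently large $n$. -/

import Mathlib

noncomputable section

namespace Stretch

/-! ### Cartan matrices, root systems, depth -/

/-- `A` is a crystallographic Cartan matrix for the Coxeter group with Coxeter matrix `M`
(in a `CoxeterMatrix`, the entry `0` encodes `∞`). -/
structure IsCartanMatrix {B : Type*} (M : CoxeterMatrix B) (A : Matrix B B ℤ) : Prop where
  diag : ∀ i, A i i = 2
  nonpos : ∀ i j, i ≠ j → A i j ≤ 0
  commuting : ∀ i j, M i j = 2 → A i j = 0
  finite : ∀ i j, 3 ≤ M i j →
    (A i j : ℝ) * (A j i : ℝ) = 4 * Real.cos (Real.pi / (M i j : ℝ)) ^ 2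
  infinite : ∀ i j, M i j = 0 → 4 ≤ A i j * A j i

section RootSystem

variable {B : Type*} [Fintype B] [DecidableEq B]

/-- The simple root at a vertex. Roots are integer-valued functions on the vertices. -/
def simpleRoot (y : B) : B → ℤ := Pi.single y 1

/-- The simple reflection `s_y`: `β ↦ β - (α_y, β) α_y`, with `(α_y, α_z) = A y z`. -/
def simpleReflection (A : Matrix B B ℤ) (y : B) (β : B → ℤ) : B → ℤ :=
  β - (∑ z, A y z * β z) • simpleRoot y

/-- The value of the expression `s_{y_k} ⋯ s_{y_1} (α_{y_0})`, for the word `[y_k, …, y_1]`. -/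
def rootExpr (A : Matrix B B ℤ) : List B → B → (B → ℤ)
  | [], y₀ => simpleRoot y₀
  | y :: w, y₀ => simpleReflection A y (rootExpr A w y₀)

/-- The root system of `A`: the union of the orbits of the simple roots under the group generated
by the (involutive) simple reflections. -/
def IsRoot (A : Matrix B B ℤ) (α : B → ℤ) : Prop :=
  ∃ (w : List B) (y₀ : B), rootExpr A w y₀ = α

def IsPositiveRoot (A : Matrix B B ℤ) (α : B → ℤ) : Prop :=
  IsRoot A α ∧ ∀ y, 0 ≤ α y

/-- `s_{y_k} ⋯ s_{y_1} (α_{y_0})` is a reduced expression for `α`, where `w = [y_k, …, y_1]`. -/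
def IsReducedExpr (A : Matrix B B ℤ) (α : B → ℤ) (w : List B) (y₀ : B) : Prop :=
  rootExpr A w y₀ = α ∧
    ∀ (w' : List B) (y₀' : B), rootExpr A w' y₀' = α → w.length ≤ w'.length

/-- The length of a reduced expression, counting the simple root it starts with. -/
def depth (A : Matrix B B ℤ) (α : B → ℤ) : ℕ :=
  sInf {k | ∃ (w : List B) (y₀ : B), rootExpr A w y₀ = α ∧ k = w.length + 1}

end RootSystem

/-! ### Hyperplanes, rank 2 subarrangements and fractures -/

section Fractures

variable {B : Type*} [Fintype B] [DecidableEq B]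

/-- The subspace `v^⊥` of `V^*`, for `v` in `V = ℝ^B`. -/
def perp (v : B → ℝ) : Submodule ℝ (StrongDual ℝ (B → ℝ)) where
  carrier := {φ | φ v = 0}
  add_mem' := by
    intro a b ha hb
    change (a + b) v = 0
    rw [add_apply, show a v = 0 from ha, show b v = 0 from hb, add_zero]
  zero_mem' := by simp
  smul_mem' := by
    intro c a ha
    change (c • a) v = 0
    rw [smul_apply, show a v = 0 from ha, smul_zero]

/-- An integral vector as an element of `V = ℝ^B`. -/
def toReal (α : B → ℤ) : B → ℝ := fun y => (α y : ℝ)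

/-- The arrangement of all reflecting hyperplanes `α^⊥`, `α` a root. -/
def arrangement (A : Matrix B B ℤ) : Set (Submodule ℝ (StrongDual ℝ (B → ℝ))) :=
  {H | ∃ α : B → ℤ, IsRoot A α ∧ H = perp (toReal α)}

/-- The base region `D`: the points that pair positively with every simple root. -/
def baseRegion (B : Type*) [Fintype B] [DecidableEq B] : Set (StrongDual ℝ (B → ℝ)) :=
  {φ | ∀ y : B, 0 < φ (toReal (simpleRoot y))}

/-- The hyperplanes of the arrangement that contain `H₁ ∩ H₂`. -/
def rankTwoSubarrangement (A : Matrix B B ℤ) (H₁ H₂ : Submodule ℝ (StrongDual ℝ (B → ℝ))) :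
    Set (Submodule ℝ (StrongDual ℝ (B → ℝ))) :=
  {H | H ∈ arrangement A ∧ H₁ ⊓ H₂ ≤ H}

/-- The region of a subarrangement `𝓑` that contains `D`: the points that no hyperplane of `𝓑`
contains or separates from a point of `D`. -/
def regionContainingBase (𝓑 : Set (Submodule ℝ (StrongDual ℝ (B → ℝ)))) :
    Set (StrongDual ℝ (B → ℝ)) :=
  {φ | ∀ H ∈ 𝓑, ∀ d ∈ baseRegion B,
    Disjoint (segment ℝ d φ) (H : Set (StrongDual ℝ (B → ℝ)))}

/-- `H` is a basic hyperplane of `𝓑`: it bounds the region containing `D`, that is, it meets the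
closure of the region in a facet (a subset of `H` that spans `H`). -/
def IsBasic (𝓑 : Set (Submodule ℝ (StrongDual ℝ (B → ℝ))))
    (H : Submodule ℝ (StrongDual ℝ (B → ℝ))) : Prop :=
  H ∈ 𝓑 ∧ Submodule.span ℝ
    (closure (regionContainingBase 𝓑) ∩ (H : Set (StrongDual ℝ (B → ℝ)))) = H

/-- `H₁` cuts `H₂`: in the rank 2 subarrangement generated by these two distinct hyperplanes,
`H₁` is basic and `H₂` is not. -/
def Cuts (A : Matrix B B ℤ) (H₁ H₂ : Submodule ℝ (StrongDual ℝ (B → ℝ))) : Prop :=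
  H₁ ∈ arrangement A ∧ H₂ ∈ arrangement A ∧ H₁ ≠ H₂ ∧
    IsBasic (rankTwoSubarrangement A H₁ H₂) H₁ ∧ ¬ IsBasic (rankTwoSubarrangement A H₁ H₂) H₂

/-- The set of fractures of a hyperplane `H`. -/
def fractures (A : Matrix B B ℤ) (H : Submodule ℝ (StrongDual ℝ (B → ℝ))) :
    Set (Submodule ℝ (StrongDual ℝ (B → ℝ))) :=
  {F | ∃ H₁, Cuts A H₁ H ∧ F = H₁ ⊓ H}

end Fractures

/-! ### Stretching -/

/-- Elastic data `(x, L_x, R_x)`: a vertex `x` of the Coxeter diagram of `M` and a partition of its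
neighbours into two (possibly empty) subsets. -/
structure ElasticData {B : Type*} (M : CoxeterMatrix B) where
  x : B
  L : Finset B
  R : Finset B
  disjoint : Disjoint L R
  mem_iff : ∀ y, (y ∈ L ∨ y ∈ R) ↔ (y ≠ x ∧ M x y ≠ 2)

section Stretching

variable {B : Type*} [Fintype B] [DecidableEq B] {M : CoxeterMatrix B}

/-- The vertices of the `n`-stretched diagram: the vertices other than `x`, and `x_0, …, x_n`. -/
abbrev StVertex (E : ElasticData M) (n : ℕ) : Type _ := {y : B // y ≠ E.x} ⊕ Fin (n + 1)

/-- The `n`-stretched Cartan matrix. -/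
def stMatrix (E : ElasticData M) (A : Matrix B B ℤ) (n : ℕ) :
    Matrix (StVertex E n) (StVertex E n) ℤ
  | Sum.inl y, Sum.inl z => A y z
  | Sum.inr i, Sum.inl z =>
      if ((i : ℕ) = 0 ∧ (z : B) ∈ E.L) ∨ ((i : ℕ) = n ∧ (z : B) ∈ E.R) then A E.x z else 0
  | Sum.inl y, Sum.inr j =>
      if ((j : ℕ) = 0 ∧ (y : B) ∈ E.L) ∨ ((j : ℕ) = n ∧ (y : B) ∈ E.R) then A y E.x else 0
  | Sum.inr i, Sum.inr j =>
      if i = j then 2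
      else if (i : ℕ) + 1 = (j : ℕ) ∨ (j : ℕ) + 1 = (i : ℕ) then -1
      else 0

/-- The stretch `st_n(α)` of an integer-valued function on the vertices. -/
def stFun (E : ElasticData M) (n : ℕ) (α : B → ℤ) : StVertex E n → ℤ
  | Sum.inl y => α y
  | Sum.inr _ => α E.x

/-- `t` is the depth growth rate of `α`. -/
def IsDepthGrowthRate (E : ElasticData M) (A : Matrix B B ℤ) (α : B → ℤ) (t : ℕ) : Prop :=
  ∀ n : ℕ, depth (stMatrix E A n) (stFun E n α) = t * n + depth A α

/-- The weighted sum `∑_{y ∈ S} -A_{xy} α(y)`; it is `S_L` for `S = L_x` and `S_R` for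
`S = R_x`. -/
def weightedSum (E : ElasticData M) (A : Matrix B B ℤ) (S : Finset B) (α : B → ℤ) : ℤ :=
  ∑ y ∈ S, -A E.x y * α y

/-- Case (1) of the trichotomy for a reflection at `x` going down from `α`: one of the two weighted
sums is less than `α(x)` and the other is equal to it. -/
def IsCaseOne (E : ElasticData M) (A : Matrix B B ℤ) (α : B → ℤ) : Prop :=
  (weightedSum E A E.L α < α E.x ∧ weightedSum E A E.R α = α E.x) ∨
    (weightedSum E A E.R α < α E.x ∧ weightedSum E A E.L α = α E.x)

/-- A type (1) expression for `α`: a reduced expression in which every reflection at `x` is in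
case (1). -/
def IsTypeOneExpr (E : ElasticData M) (A : Matrix B B ℤ) (α : B → ℤ) (w : List B) (y₀ : B) :
    Prop :=
  IsReducedExpr A α w y₀ ∧
    ∀ v : List B, (E.x :: v) <:+ w → IsCaseOne E A (rootExpr A (E.x :: v) y₀)

/-! ### The uniform description of the fractures -/

/-- `β_y = α_y` for a vertex `y` off the stretched path. -/
def betaOff (E : ElasticData M) (n : ℕ) (y : {y : B // y ≠ E.x}) : StVertex E n → ℝ :=
  toReal (simpleRoot (Sum.inl y))

/-- `β_{x_i} = α_{x_0} + ⋯ + α_{x_i}` (used for `i ≤ n`). -/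
def betaPath (E : ElasticData M) (n : ℕ) (i : ℕ) : StVertex E n → ℝ :=
  ∑ j : Fin (n + 1), if (j : ℕ) ≤ i then toReal (simpleRoot (Sum.inr j)) else 0

/-- The formal symbols `β_y` (`y ≠ x` a vertex of the unstretched diagram), `β_{x_0}, …, β_{x_r}`
(left `k` stands for `β_{x_k}`) and `β_{x_{n-r}}, …, β_{x_n}` (right `k` stands for
`β_{x_{n-k}}`). They do not involve `n`. -/
inductive FormSymbol (E : ElasticData M) (r : ℕ) : Type _
  | off (y : {y : B // y ≠ E.x}) : FormSymbol E r
  | left (k : Fin (r + 1)) : FormSymbol E r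
  | right (k : Fin (r + 1)) : FormSymbol E r

/-- Formal linear combinations of these symbols. -/
abbrev Form (E : ElasticData M) (r : ℕ) : Type _ := FormSymbol E r → ℝ

/-- The vector on the `n`-stretched diagram that a formal linear combination stands for. -/
def Form.eval {E : ElasticData M} {r : ℕ} (c : Form E r) (n : ℕ) : StVertex E n → ℝ :=
  (∑ y : {y : B // y ≠ E.x}, c (FormSymbol.off y) • betaOff E n y) +
    (∑ k : Fin (r + 1), c (FormSymbol.left k) • betaPath E n k) +
    ∑ k : Fin (r + 1), c (FormSymbol.right k) • betaPath E n (n - k)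

/-- The arrangement `{f_i^⊥} ∪ {(g_i - β_{x_j})^⊥ : r + 1 ≤ j ≤ n - r - 1}`. -/
def formArrangement (E : ElasticData M) {r s t : ℕ} (f : Fin s → Form E r) (g : Fin t → Form E r)
    (n : ℕ) : Set (Submodule ℝ (StrongDual ℝ (StVertex E n → ℝ))) :=
  {H | ∃ i : Fin s, H = perp ((f i).eval n)} ∪
    {H | ∃ (i : Fin t) (j : ℕ), r + 1 ≤ j ∧ j + r + 1 ≤ n ∧
      H = perp ((g i).eval n - betaPath E n j)}

/-- The fractures of `st_n(α)^⊥` are precisely the intersections of `st_n(α)^⊥` with the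
hyperplanes of `formArrangement E f g n`. -/
def FracturesGivenBy (E : ElasticData M) (A : Matrix B B ℤ) (α : B → ℤ) {r s t : ℕ}
    (f : Fin s → Form E r) (g : Fin t → Form E r) (n : ℕ) : Prop :=
  fractures (stMatrix E A n) (perp (toReal (stFun E n α))) =
    {F | ∃ H ∈ formArrangement E f g n, F = H ⊓ perp (toReal (stFun E n α))}

end Stretching

end Stretch

end

set_option linter.unusedSectionVars false

/-! The proof rests on the inversions of a positive root `α`: the positive roots other than `±α`
that the reflection `t_α` makes negative. Depth and fractures are both read off from them, and
stretching changes them in a controlled way.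

A descent `s_y` of `α` removes exactly two inversions, and any simple reflection adds at most two,
so `α` has `2 (depth α - 1)` of them (`IsGCM.ncard_inv_add_two`). In a plane of roots through `α`,
the hyperplane of `α` fails to be basic exactly when the plane contains an inversion, so the
fractures of `α^⊥` are its intersections with the hyperplanes of its inversions
(`IsGCM.fractures_eq`). Both facts use that roots and their coroots have a common sign
(`IsGCM.sign_coherent`), which is proved for every generalized Cartan matrix, hence for stretched
matrices too.

Stretching preserves the pairing of coroots with roots (`pairing_stFun_stFun`), so it intertwines
reflections: `s_y` becomes the reflection in `st_n(α_y)`. For `y = x` that root is `β_{x_n}`, the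
highest root of a path of type A, and its reflection negates also the roots `β_{x_j}` and `β_{x_n} -
β_{x_j}`. Every inversion of `st_n(α)` is consequently `st_n(f)` or `st_n(f) ± β_{x_j}` with `j <
n`. Reflections in stretched roots preserve the jump position `j` and its sign, and act on `f` by a
formula free of `n` and `j` (`reflect_stFun_add_smul_beta`). Induction along descents then gives
`isUniform`: the inversions without a jump are the stretches of those of `α`, and those of the form
`st_n(g) - β_{x_j}` are given by one set of functions `g`, the same for all `n` and all `j < n`.

This set is a finite `G`. The involution `γ ↦ -t_α γ` on inversions exchanges jumps `-1` and `+1`,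
so there are `2 |G| n` inversions with a jump, and the growth rate is `t = |G|`. The involution
leaves the fracture unchanged, so the fractures come from the `st_n(f)` and the `st_n(g) - β_{x_j}`,
which is the required uniform description. -/

namespace Stretch

open CoxeterSystem (alternatingWord alternatingWord_succ alternatingWord_succ')

/-! ### Sign coherence of roots and coroots for generalized Cartan matrices. -/

section Words

variable {B : Type*} [Fintype B] [DecidableEq B]

/-- Generalized Cartan matrices. -/
structure IsGCM (A : Matrix B B ℤ) : Prop where
  diag : ∀ i, A i i = 2
  nonpos : ∀ i j, i ≠ j → A i j ≤ 0
  zero : ∀ i j, A i j = 0 → A j i = 0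

theorem IsGCM.transpose {A : Matrix B B ℤ} (hA : IsGCM A) : IsGCM A.transpose :=
  ⟨fun i => hA.diag i, fun i j h => hA.nonpos j i h.symm, fun i j h => hA.zero j i h⟩

/-- The simple reflection as a linear map. -/
noncomputable def simpleEnd (A : Matrix B B ℤ) (y : B) : Module.End ℤ (B → ℤ) where
  toFun := simpleReflection A y
  map_add' u v := by
    simp only [simpleReflection, Pi.add_apply, mul_add, Finset.sum_add_distrib, add_smul]
    abel
  map_smul' c v := by
    simp only [simpleReflection, Pi.smul_apply, smul_eq_mul, RingHom.id_apply, smul_sub,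
      smul_smul, Finset.mul_sum]
    congr 2
    exact Finset.sum_congr rfl fun z _ => by ring

/-- The action of a word in the simple reflections. -/
noncomputable def wordEnd (A : Matrix B B ℤ) (w : List B) : Module.End ℤ (B → ℤ) :=
  (w.map (simpleEnd A)).prod

@[simp] theorem wordEnd_nil (A : Matrix B B ℤ) : wordEnd A [] = 1 := rfl

theorem wordEnd_cons (A : Matrix B B ℤ) (y : B) (w : List B) (v : B → ℤ) :
    wordEnd A (y :: w) v = simpleReflection A y (wordEnd A w v) := by
  simp only [wordEnd, List.map_cons, List.prod_cons, Module.End.mul_apply]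
  rfl

theorem wordEnd_append (A : Matrix B B ℤ) (w w' : List B) :
    wordEnd A (w ++ w') = wordEnd A w * wordEnd A w' := by
  simp [wordEnd]

theorem wordEnd_append_apply (A : Matrix B B ℤ) (w w' : List B) (v : B → ℤ) :
    wordEnd A (w ++ w') v = wordEnd A w (wordEnd A w' v) := by
  rw [wordEnd_append, Module.End.mul_apply]

theorem rootExpr_eq_wordEnd (A : Matrix B B ℤ) (w : List B) (y : B) :
    rootExpr A w y = wordEnd A w (simpleRoot y) := by
  induction w with
  | nil => rfl
  | cons z w ih => rw [wordEnd_cons, ← ih, rootExpr]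

theorem sum_mul_simpleRoot (f : B → ℤ) (y : B) : ∑ z, f z * simpleRoot y z = f y := by
  simp [simpleRoot, Pi.single_apply]

theorem simpleReflection_simpleRoot (A : Matrix B B ℤ) (y z : B) :
    simpleReflection A y (simpleRoot z) = simpleRoot z - A y z • simpleRoot y := by
  rw [simpleReflection, sum_mul_simpleRoot]

theorem simpleReflection_add (A : Matrix B B ℤ) (y : B) (u v : B → ℤ) :
    simpleReflection A y (u + v) = simpleReflection A y u + simpleReflection A y v :=
  (simpleEnd A y).map_add u v

theorem simpleReflection_smul (A : Matrix B B ℤ) (y : B) (c : ℤ) (v : B → ℤ) :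
    simpleReflection A y (c • v) = c • simpleReflection A y v :=
  (simpleEnd A y).map_smul c v

theorem simpleReflection_neg (A : Matrix B B ℤ) (y : B) (v : B → ℤ) :
    simpleReflection A y (-v) = -simpleReflection A y v :=
  (simpleEnd A y).map_neg v

theorem simpleReflection_sub (A : Matrix B B ℤ) (y : B) (u v : B → ℤ) :
    simpleReflection A y (u - v) = simpleReflection A y u - simpleReflection A y v :=
  (simpleEnd A y).map_sub u v

theorem IsGCM.simpleReflection_self {A : Matrix B B ℤ} (hA : IsGCM A) (y : B) :
    simpleReflection A y (simpleRoot y) = -simpleRoot y := by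
  rw [simpleReflection_simpleRoot, hA.diag]; module

theorem IsGCM.simpleReflection_invol {A : Matrix B B ℤ} (hA : IsGCM A) (y : B) (v : B → ℤ) :
    simpleReflection A y (simpleReflection A y v) = v := by
  conv_lhs => rw [simpleReflection.eq_1 A y v]
  rw [simpleReflection_sub, simpleReflection_smul, hA.simpleReflection_self, simpleReflection]
  module

/-- Two words act in the same way on the roots and on the coroots. -/
def WordEquiv (A : Matrix B B ℤ) (w w' : List B) : Prop :=
  wordEnd A w = wordEnd A w' ∧ wordEnd A.transpose w = wordEnd A.transpose w'

theorem WordEquiv.refl (A : Matrix B B ℤ) (w : List B) : WordEquiv A w w := ⟨rfl, rfl⟩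

theorem WordEquiv.symm {A : Matrix B B ℤ} {w w' : List B} (h : WordEquiv A w w') :
    WordEquiv A w' w := ⟨h.1.symm, h.2.symm⟩

theorem WordEquiv.trans {A : Matrix B B ℤ} {w w' w'' : List B} (h : WordEquiv A w w')
    (h' : WordEquiv A w' w'') : WordEquiv A w w'' := ⟨h.1.trans h'.1, h.2.trans h'.2⟩

theorem WordEquiv.append {A : Matrix B B ℤ} {u u' w w' : List B} (h : WordEquiv A u u')
    (h' : WordEquiv A w w') : WordEquiv A (u ++ w) (u' ++ w') :=
  ⟨by rw [wordEnd_append, wordEnd_append, h.1, h'.1],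
   by rw [wordEnd_append, wordEnd_append, h.2, h'.2]⟩

theorem IsGCM.wordEquiv_pair {A : Matrix B B ℤ} (hA : IsGCM A) (s : B) :
    WordEquiv A [s, s] [] := by
  constructor <;> refine LinearMap.ext fun v => ?_
  · rw [wordEnd_cons, wordEnd_cons]; exact hA.simpleReflection_invol s v
  · rw [wordEnd_cons, wordEnd_cons]; exact hA.transpose.simpleReflection_invol s v

theorem simpleReflection_shift_left {A : Matrix B B ℤ} (hA : IsGCM A) (s t : B) (v : B → ℤ)
    (P Q : ℤ) :
    simpleReflection A s (v + P • simpleRoot s + Q • simpleRoot t) =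
      v + (-P - (∑ z, A s z * v z) - A s t * Q) • simpleRoot s + Q • simpleRoot t := by
  rw [simpleReflection_add, simpleReflection_add, simpleReflection_smul, simpleReflection_smul,
    hA.simpleReflection_self, simpleReflection_simpleRoot, simpleReflection]
  module

theorem simpleReflection_shift_right {A : Matrix B B ℤ} (hA : IsGCM A) (s t : B) (v : B → ℤ)
    (P Q : ℤ) :
    simpleReflection A t (v + P • simpleRoot s + Q • simpleRoot t) =
      v + P • simpleRoot s + (-Q - (∑ z, A t z * v z) - A t s * P) • simpleRoot t := by
  rw [simpleReflection_add, simpleReflection_add, simpleReflection_smul, simpleReflection_smul,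
    hA.simpleReflection_self, simpleReflection_simpleRoot, simpleReflection]
  module

/-- On vectors `v + P α_s + Q α_t` with `v` fixed, the two reflections act by explicit affine maps
of `(P, Q)`. Starting from `P = Q = 0`, both alternating words are computed and compared case by
case. -/
theorem IsGCM.braid {A : Matrix B B ℤ} (hA : IsGCM A) {s t : B} {m : ℕ}
    (h : (A s t = 0 ∧ A t s = 0 ∧ m = 2) ∨ (A s t = -1 ∧ A t s = -1 ∧ m = 3) ∨
      (A s t = -1 ∧ A t s = -2 ∧ m = 4) ∨ (A s t = -2 ∧ A t s = -1 ∧ m = 4) ∨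
      (A s t = -1 ∧ A t s = -3 ∧ m = 6) ∨ (A s t = -3 ∧ A t s = -1 ∧ m = 6)) :
    wordEnd A (alternatingWord s t m) = wordEnd A (alternatingWord t s m) := by
  refine LinearMap.ext fun v => ?_
  have hv : v = v + (0 : ℤ) • simpleRoot s + (0 : ℤ) • simpleRoot t := by simp
  rcases h with h | h | h | h | h | h <;> obtain ⟨h1, h2, rfl⟩ := h <;>
  · simp only [alternatingWord, List.concat_eq_append, List.nil_append, List.cons_append,
      wordEnd_cons, wordEnd_nil, Module.End.one_apply]
    rw [hv]
    simp only [simpleReflection_shift_left hA s t v, simpleReflection_shift_right hA s t v,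
      h1, h2]
    congr 1
    · congr 2; ring
    · congr 1; ring

/-- The coefficients of the image of `α_s` under an alternating word ending in `t`. -/
def altCoef (a b : ℤ) : ℕ → ℤ × ℤ
  | 0 => (1, 0)
  | k + 1 => if Even k then ((altCoef a b k).1, -(altCoef a b k).2 - b * (altCoef a b k).1)
      else (-(altCoef a b k).1 - a * (altCoef a b k).2, (altCoef a b k).2)

theorem IsGCM.wordEnd_alternatingWord {A : Matrix B B ℤ} (hA : IsGCM A) (s t : B) (k : ℕ) :
    wordEnd A (alternatingWord s t k) (simpleRoot s) =
      (altCoef (A s t) (A t s) k).1 • simpleRoot s +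
        (altCoef (A s t) (A t s) k).2 • simpleRoot t := by
  induction k with
  | zero => simp [altCoef, alternatingWord]
  | succ k ih =>
    rw [alternatingWord_succ', wordEnd_cons, ih, altCoef]
    split_ifs with h <;>
    · rw [simpleReflection_add, simpleReflection_smul, simpleReflection_smul,
        hA.simpleReflection_self, simpleReflection_simpleRoot]
      module

theorem altCoef_nonneg_of_four_le {a b : ℤ} (ha : a ≤ 0) (hb : b ≤ 0) (hab : 4 ≤ a * b) (k : ℕ) :
    0 ≤ (altCoef a b k).1 ∧ 0 ≤ (altCoef a b k).2 ∧
      (Even k → -a * (altCoef a b k).2 ≤ 2 * (altCoef a b k).1) ∧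
      (¬ Even k → -b * (altCoef a b k).1 ≤ 2 * (altCoef a b k).2) := by
  induction k with
  | zero => simp [altCoef]
  | succ k ih =>
    obtain ⟨hx, hy, h1, h2⟩ := ih
    rw [altCoef]
    set x := (altCoef a b k).1
    set y := (altCoef a b k).2
    by_cases h : Even k
    · have h1 := h1 h
      rw [if_pos h]
      -- This is where `ab ≥ 4` enters: multiplying `-a y ≤ 2 x` by `-b` gives `4 y ≤ ab y ≤ -2 b
      -- x`, so the reflected coefficient still dominates.
      have h3 : 2 * y ≤ -b * x := by
        have : -b * (-a * y) ≤ -b * (2 * x) := mul_le_mul_of_nonneg_left h1 (by omega)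
        nlinarith
      refine ⟨hx, by linarith, fun h' => absurd h (by simpa [Nat.even_add_one] using h'),
        fun _ => by linarith⟩
    · have h2 := h2 h
      rw [if_neg h]
      have h3 : 2 * x ≤ -a * y := by
        have : -a * (-b * x) ≤ -a * (2 * y) := mul_le_mul_of_nonneg_left h2 (by omega)
        nlinarith
      refine ⟨by linarith, hy, fun _ => by linarith,
        fun h' => absurd (by simpa [Nat.even_add_one] using h') h⟩

theorem altCoef_nonneg_of_finite {a b : ℤ} {m : ℕ}
    (h : (a = 0 ∧ b = 0 ∧ m = 2) ∨ (a = -1 ∧ b = -1 ∧ m = 3) ∨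
      (a = -1 ∧ b = -2 ∧ m = 4) ∨ (a = -2 ∧ b = -1 ∧ m = 4) ∨
      (a = -1 ∧ b = -3 ∧ m = 6) ∨ (a = -3 ∧ b = -1 ∧ m = 6)) :
    ∀ k < m, 0 ≤ (altCoef a b k).1 ∧ 0 ≤ (altCoef a b k).2 := by
  rcases h with h | h | h | h | h | h <;> obtain ⟨rfl, rfl, rfl⟩ := h <;> decide

theorem IsGCM.finite_or_four_le {A : Matrix B B ℤ} (hA : IsGCM A) {s t : B} (hst : s ≠ t) :
    (∃ m, (A s t = 0 ∧ A t s = 0 ∧ m = 2) ∨ (A s t = -1 ∧ A t s = -1 ∧ m = 3) ∨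
      (A s t = -1 ∧ A t s = -2 ∧ m = 4) ∨ (A s t = -2 ∧ A t s = -1 ∧ m = 4) ∨
      (A s t = -1 ∧ A t s = -3 ∧ m = 6) ∨ (A s t = -3 ∧ A t s = -1 ∧ m = 6)) ∨
      4 ≤ A s t * A t s := by
  by_cases h4 : 4 ≤ A s t * A t s
  · exact Or.inr h4
  left
  have ha := hA.nonpos s t hst
  have hb := hA.nonpos t s hst.symm
  have hz := hA.zero s t
  have hz' := hA.zero t s
  generalize A s t = a at *
  generalize A t s = b at *
  rcases eq_or_ne a 0 with rfl | ha0
  · exact ⟨2, by simp [hz rfl]⟩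
  have hb0 : b ≠ 0 := fun h => ha0 (hz' h)
  have ha1 : -3 ≤ a := by nlinarith [lt_of_le_of_ne hb hb0]
  have hb1 : -3 ≤ b := by nlinarith [lt_of_le_of_ne ha ha0]
  interval_cases a <;> interval_cases b <;> simp_all

/-- The image of `α_s` under a word is a nonnegative combination of `α_s` and `α_t`, and likewise
for coroots. -/
def NonnegComb (A : Matrix B B ℤ) (w : List B) (s t : B) : Prop :=
  (∃ x y : ℤ, 0 ≤ x ∧ 0 ≤ y ∧
    wordEnd A w (simpleRoot s) = x • simpleRoot s + y • simpleRoot t) ∧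
  ∃ x y : ℤ, 0 ≤ x ∧ 0 ≤ y ∧
    wordEnd A.transpose w (simpleRoot s) = x • simpleRoot s + y • simpleRoot t

theorem IsGCM.rankTwo {A : Matrix B B ℤ} (hA : IsGCM A) {s t : B} (hst : s ≠ t) :
    (∃ m, 1 ≤ m ∧ WordEquiv A (alternatingWord s t m) (alternatingWord t s m) ∧
      ∀ k < m, NonnegComb A (alternatingWord s t k) s t) ∨
    ∀ k, NonnegComb A (alternatingWord s t k) s t := by
  rcases hA.finite_or_four_le hst with ⟨m, h⟩ | h
  · left
    have h' : (A.transpose s t = 0 ∧ A.transpose t s = 0 ∧ m = 2) ∨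
        (A.transpose s t = -1 ∧ A.transpose t s = -1 ∧ m = 3) ∨
        (A.transpose s t = -1 ∧ A.transpose t s = -2 ∧ m = 4) ∨
        (A.transpose s t = -2 ∧ A.transpose t s = -1 ∧ m = 4) ∨
        (A.transpose s t = -1 ∧ A.transpose t s = -3 ∧ m = 6) ∨
        (A.transpose s t = -3 ∧ A.transpose t s = -1 ∧ m = 6) := by
      simp only [Matrix.transpose_apply]; tauto
    refine ⟨m, by omega, ⟨hA.braid h, hA.transpose.braid h'⟩, fun k hk => ?_⟩
    have h1 := altCoef_nonneg_of_finite h k hk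
    have h2 := altCoef_nonneg_of_finite h' k hk
    exact ⟨⟨_, _, h1.1, h1.2, hA.wordEnd_alternatingWord s t k⟩,
      ⟨_, _, h2.1, h2.2, hA.transpose.wordEnd_alternatingWord s t k⟩⟩
  · right
    intro k
    have h1 := altCoef_nonneg_of_four_le (hA.nonpos s t hst) (hA.nonpos t s hst.symm) h k
    have h2 := altCoef_nonneg_of_four_le (hA.transpose.nonpos s t hst)
      (hA.transpose.nonpos t s hst.symm) (by rwa [Matrix.transpose_apply, Matrix.transpose_apply,
        mul_comm]) k
    exact ⟨⟨_, _, h1.1, h1.2.1, hA.wordEnd_alternatingWord s t k⟩,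
      ⟨_, _, h2.1, h2.2.1, hA.transpose.wordEnd_alternatingWord s t k⟩⟩

/-- The image of `α_s` under a word is nonnegative, and likewise for the coroot. -/
def WordNonneg (A : Matrix B B ℤ) (w : List B) (s : B) : Prop :=
  0 ≤ wordEnd A w (simpleRoot s) ∧ 0 ≤ wordEnd A.transpose w (simpleRoot s)

theorem simpleRoot_nonneg (s : B) : 0 ≤ simpleRoot s := by
  intro z
  by_cases h : z = s <;> simp [simpleRoot, h]

theorem NonnegComb.wordNonneg_append {A : Matrix B B ℤ} {v u : List B} {s t : B}
    (h : NonnegComb A u s t) (hs : WordNonneg A v s) (ht : WordNonneg A v t) :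
    WordNonneg A (v ++ u) s := by
  obtain ⟨⟨x, y, hx, hy, h1⟩, ⟨x', y', hx', hy', h2⟩⟩ := h
  constructor
  · rw [wordEnd_append_apply, h1, map_add, map_smul, map_smul]
    exact add_nonneg (smul_nonneg hx hs.1) (smul_nonneg hy ht.1)
  · rw [wordEnd_append_apply, h2, map_add, map_smul, map_smul]
    exact add_nonneg (smul_nonneg hx' hs.2) (smul_nonneg hy' ht.2)

theorem alternatingWord_eq_append (s t : B) (m k : ℕ) :
    ∃ p : List B, p.length = k ∧ alternatingWord s t (k + m) = p ++ alternatingWord s t m := by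
  induction k with
  | zero => exact ⟨[], rfl, by simp⟩
  | succ k ih =>
    obtain ⟨p, hp, h⟩ := ih
    refine ⟨(if Even (k + m) then t else s) :: p, by simp [hp], ?_⟩
    rw [show k + 1 + m = (k + m) + 1 by omega, alternatingWord_succ', h, List.cons_append]

/-- If no word shorter than `w` acts as `w` or as `w s`, then `w` keeps `α_s` positive. -/
theorem IsGCM.wordNonneg_of_minimal {A : Matrix B B ℤ} (hA : IsGCM A) (w : List B)
    (hw : ∀ w', WordEquiv A w' w → w.length ≤ w'.length) (s : B)
    (hs : ∀ w', WordEquiv A w' (w ++ [s]) → w.length ≤ w'.length) : WordNonneg A w s := by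
  induction hn : w.length using Nat.strong_induction_on generalizing w s with
  | _ n ih =>
  subst hn
  rcases List.eq_nil_or_concat w with rfl | ⟨w₀, t, hw₀⟩
  · exact ⟨by simpa using simpleRoot_nonneg s, by simpa using simpleRoot_nonneg s⟩
  rw [List.concat_eq_append] at hw₀
  have hst : s ≠ t := by
    rintro rfl
    have := hs w₀ (by
      rw [hw₀, List.append_assoc]
      simpa using (WordEquiv.refl A w₀).append (hA.wordEquiv_pair s).symm)
    rw [hw₀] at this
    simp at this
  -- Among words of the same length acting as `w`, take one with the longest alternating suffix in
  -- `s` and `t`. Its prefix `v` is shortest for its action; minimality of `w` and maximality of the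
  -- suffix show that neither letter shortens `v`, so induction applies to `v` at both.
  let K : ℕ → Prop := fun k => ∃ v : List B, v.length + k = w.length ∧
    WordEquiv A (v ++ alternatingWord s t k) w
  have hK1 : K 1 := ⟨w₀, by simp [hw₀], by simpa [hw₀, alternatingWord] using WordEquiv.refl A _⟩
  have hKb : ∀ k, K k → k ≤ w.length := fun k ⟨v, hv, _⟩ => by omega
  classical
  obtain ⟨k, hk1, hk, hkmax⟩ : ∃ k, 1 ≤ k ∧ K k ∧ ∀ j, K j → j ≤ k :=
    ⟨Nat.findGreatest K w.length, Nat.le_findGreatest (hKb 1 hK1) hK1,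
      Nat.findGreatest_spec (hKb 1 hK1) hK1, fun j hj => Nat.le_findGreatest (hKb j hj) hj⟩
  obtain ⟨v, hvk, hv⟩ := hk
  have hvmin : ∀ v', WordEquiv A v' v → v.length ≤ v'.length := fun v' h => by
    have := hw (v' ++ alternatingWord s t k) ((h.append (WordEquiv.refl A _)).trans hv)
    rw [List.length_append, CoxeterSystem.length_alternatingWord] at this
    omega
  obtain ⟨k, rfl⟩ : ∃ j, k = j + 1 := ⟨k - 1, by omega⟩
  have hfirst : ∀ v', WordEquiv A v' (v ++ [if Even k then t else s]) →
      v.length ≤ v'.length := fun v' h => by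
    have h1 : WordEquiv A (v' ++ alternatingWord s t k) w := by
      refine ((h.append (WordEquiv.refl A _)).trans ?_).trans hv
      rw [List.append_assoc, alternatingWord_succ']
      exact WordEquiv.refl A _
    have := hw _ h1
    rw [List.length_append, CoxeterSystem.length_alternatingWord] at this
    omega
  have hnext : ∀ v', WordEquiv A v' (v ++ [if Even (k + 1) then t else s]) →
      v.length ≤ v'.length := fun v' h => by
    by_contra hlt
    have h1 : WordEquiv A (v' ++ alternatingWord s t (k + 2)) w := by
      refine ((h.append (WordEquiv.refl A _)).trans ?_).trans hv
      rw [List.append_assoc, alternatingWord_succ' s t (k + 1)]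
      refine (WordEquiv.refl A v).append ?_
      exact (hA.wordEquiv_pair _).append (WordEquiv.refl A (alternatingWord s t (k + 1)))
    have h2 := hw _ h1
    rw [List.length_append, CoxeterSystem.length_alternatingWord] at h2
    have := hkmax (k + 2) ⟨v', by omega, h1⟩
    omega
  have hboth : ∀ e, e = s ∨ e = t → WordNonneg A v e := by
    have h1 := ih v.length (by omega) v hvmin _ hfirst rfl
    have h2 := ih v.length (by omega) v hvmin _ hnext rfl
    by_cases hpar : Even k
    · rw [if_pos hpar] at h1
      rw [if_neg (by simpa [Nat.even_add_one] using hpar)] at h2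
      rintro e (rfl | rfl) <;> assumption
    · rw [if_neg hpar] at h1
      rw [if_pos (by simpa [Nat.even_add_one] using hpar)] at h2
      rintro e (rfl | rfl) <;> assumption
  -- If the suffix reached the braid length `m`, the braid relation would let it end in `s`, and `w
  -- s` would cancel to a word shorter than `w`.
  have hcomb : NonnegComb A (alternatingWord s t (k + 1)) s t := by
    rcases hA.rankTwo hst with ⟨m, hm1, hm, h⟩ | h
    · refine h _ ?_
      by_contra hle
      obtain ⟨j, hj⟩ : ∃ j, k + 1 = j + m := ⟨k + 1 - m, by omega⟩
      obtain ⟨p, hp, hpe⟩ := alternatingWord_eq_append s t m j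
      obtain ⟨m, rfl⟩ : ∃ i, m = i + 1 := ⟨m - 1, by omega⟩
      have h1 : WordEquiv A (v ++ (p ++ alternatingWord s t m)) (w ++ [s]) := by
        have h2 : WordEquiv A w (v ++ (p ++ (alternatingWord s t m ++ [s]))) := by
          refine hv.symm.trans ((WordEquiv.refl A v).append ?_)
          rw [hj, hpe]
          refine (WordEquiv.refl A p).append (hm.trans ?_)
          rw [alternatingWord_succ t s m, List.concat_eq_append]
          exact WordEquiv.refl A _
        refine WordEquiv.symm ((h2.append (WordEquiv.refl A [s])).trans ?_)
        simp only [List.append_assoc]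
        refine (WordEquiv.refl A v).append ((WordEquiv.refl A p).append ?_)
        simpa using (WordEquiv.refl A (alternatingWord s t m)).append (hA.wordEquiv_pair s)
      have := hs _ h1
      simp only [List.length_append, CoxeterSystem.length_alternatingWord] at this
      omega
    · exact h _
  have := hcomb.wordNonneg_append (hboth s (Or.inl rfl)) (hboth t (Or.inr rfl))
  rw [WordNonneg, hv.1, hv.2] at this
  exact this

/-- Compare shortest words acting as `w` and as `w y`. Whichever is no longer keeps `α_y` positive,
and in the second case `w` acts as that word followed on the right by `s_y`, so the sign flips.
Since equivalence of words concerns roots and coroots at once, the two signs agree. -/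
theorem IsGCM.sign_coherent {A : Matrix B B ℤ} (hA : IsGCM A) (w : List B) (y : B) :
    (0 ≤ rootExpr A w y ∧ 0 ≤ rootExpr A.transpose w y) ∨
      (rootExpr A w y ≤ 0 ∧ rootExpr A.transpose w y ≤ 0) := by
  have key : ∀ u : List B, ∃ w₁, WordEquiv A w₁ u ∧
      ∀ w', WordEquiv A w' u → w₁.length ≤ w'.length := fun u => by
    classical
    have hex : ∃ n, ∃ w₁, WordEquiv A w₁ u ∧ w₁.length = n := ⟨_, u, WordEquiv.refl A u, rfl⟩
    obtain ⟨w₁, h1, h2⟩ := Nat.find_spec hex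
    exact ⟨w₁, h1, fun w' h' => h2 ▸ Nat.find_min' hex ⟨w', h', rfl⟩⟩
  simp only [rootExpr_eq_wordEnd]
  obtain ⟨w₁, h1, hmin⟩ := key w
  obtain ⟨w₂, h2, hmin2⟩ := key (w ++ [y])
  by_cases hlen : w₁.length ≤ w₂.length
  · left
    have := hA.wordNonneg_of_minimal w₁ (fun w' h => hmin w' (h.trans h1)) y
      (fun w' h => hlen.trans (hmin2 w' (h.trans (h1.append (WordEquiv.refl A [y])))))
    rwa [WordNonneg, h1.1, h1.2] at this
  · right
    have h3 : WordEquiv A (w₂ ++ [y]) w := by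
      refine (h2.append (WordEquiv.refl A [y])).trans ?_
      rw [List.append_assoc]
      simpa using (WordEquiv.refl A w).append (hA.wordEquiv_pair y)
    have := hA.wordNonneg_of_minimal w₂ (fun w' h => hmin2 w' (h.trans h2)) y
      (fun w' h => (not_le.1 hlen).le.trans (hmin w' (h.trans h3)))
    rw [WordNonneg, h2.1, h2.2, wordEnd_append_apply, wordEnd_append_apply, wordEnd_cons,
      wordEnd_cons, wordEnd_nil, wordEnd_nil, Module.End.one_apply,
      hA.simpleReflection_self, hA.transpose.simpleReflection_self, map_neg, map_neg] at this
    exact ⟨neg_nonneg.1 this.1, neg_nonneg.1 this.2⟩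

end Words

/-! ### Roots with their coroots, and the reflections they define. -/

section Biroots

variable {B : Type*} [Fintype B] [DecidableEq B]

/-- The pairing of a coroot (or coweight) vector with a root vector. -/
def pairing (A : Matrix B B ℤ) (φ v : B → ℤ) : ℤ := φ ⬝ᵥ A.mulVec v

/-- The reflection attached to a root `α` with coroot `φ`. -/
def reflect (A : Matrix B B ℤ) (α φ v : B → ℤ) : B → ℤ := v - pairing A φ v • α

theorem pairing_transpose (A : Matrix B B ℤ) (φ v : B → ℤ) :
    pairing A.transpose v φ = pairing A φ v := by
  rw [pairing, pairing, Matrix.mulVec_transpose, dotProduct_comm, Matrix.dotProduct_mulVec]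

@[simp] theorem pairing_add_right (A : Matrix B B ℤ) (φ u v : B → ℤ) :
    pairing A φ (u + v) = pairing A φ u + pairing A φ v := by
  simp [pairing, Matrix.mulVec_add]

@[simp] theorem pairing_sub_right (A : Matrix B B ℤ) (φ u v : B → ℤ) :
    pairing A φ (u - v) = pairing A φ u - pairing A φ v := by
  simp [pairing, Matrix.mulVec_sub]

@[simp] theorem pairing_neg_right (A : Matrix B B ℤ) (φ v : B → ℤ) :
    pairing A φ (-v) = -pairing A φ v := by
  simp [pairing, Matrix.mulVec_neg]

@[simp] theorem pairing_smul_right (A : Matrix B B ℤ) (φ v : B → ℤ) (c : ℤ) :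
    pairing A φ (c • v) = c * pairing A φ v := by
  rw [pairing, Matrix.mulVec_smul, dotProduct_smul, smul_eq_mul, pairing]

@[simp] theorem pairing_sub_left (A : Matrix B B ℤ) (φ ψ v : B → ℤ) :
    pairing A (φ - ψ) v = pairing A φ v - pairing A ψ v := by
  simp [pairing]

@[simp] theorem pairing_smul_left (A : Matrix B B ℤ) (φ v : B → ℤ) (c : ℤ) :
    pairing A (c • φ) v = c * pairing A φ v := by
  rw [pairing, smul_dotProduct, smul_eq_mul, pairing]

theorem pairing_simpleRoot_left (A : Matrix B B ℤ) (y : B) (v : B → ℤ) :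
    pairing A (simpleRoot y) v = ∑ z, A y z * v z := by
  rw [pairing, simpleRoot, single_one_dotProduct, Matrix.mulVec, dotProduct]

theorem pairing_simpleRoot_simpleRoot (A : Matrix B B ℤ) (y z : B) :
    pairing A (simpleRoot y) (simpleRoot z) = A y z := by
  rw [pairing_simpleRoot_left, sum_mul_simpleRoot]

theorem pairing_eq_sum (A : Matrix B B ℤ) (φ v : B → ℤ) :
    pairing A φ v = ∑ y, v y * pairing A φ (simpleRoot y) := by
  rw [← pairing_transpose, pairing, dotProduct]
  refine Finset.sum_congr rfl fun y _ => ?_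
  rw [← pairing_transpose, pairing_simpleRoot_left, Matrix.mulVec, dotProduct]

theorem simpleReflection_eq_reflect (A : Matrix B B ℤ) (y : B) (v : B → ℤ) :
    simpleReflection A y v = reflect A (simpleRoot y) (simpleRoot y) v := by
  rw [reflect, pairing_simpleRoot_left, simpleReflection]

theorem reflect_neg (A : Matrix B B ℤ) (α φ v : B → ℤ) :
    reflect A α φ (-v) = -reflect A α φ v := by
  simp only [reflect, pairing_neg_right]; module

theorem reflect_self {A : Matrix B B ℤ} {α φ : B → ℤ} (h : pairing A φ α = 2) :
    reflect A α φ α = -α := by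
  rw [reflect, h]; module

theorem reflect_reflect {A : Matrix B B ℤ} {α φ : B → ℤ} (h : pairing A φ α = 2) (v : B → ℤ) :
    reflect A α φ (reflect A α φ v) = v := by
  simp only [reflect, pairing_sub_right, pairing_smul_right, h]; module

theorem pairing_reflect_reflect {A : Matrix B B ℤ} {ξ ζ : B → ℤ} (h : pairing A ζ ξ = 2)
    (φ v : B → ℤ) :
    pairing A (reflect A.transpose ζ ξ φ) (reflect A ξ ζ v) = pairing A φ v := by
  simp only [reflect, pairing_sub_right, pairing_smul_right, pairing_sub_left,
    pairing_smul_left, pairing_transpose, h]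
  ring

theorem reflect_conj {A : Matrix B B ℤ} {ξ ζ : B → ℤ} (h : pairing A ζ ξ = 2) (α φ v : B → ℤ) :
    reflect A (reflect A ξ ζ α) (reflect A.transpose ζ ξ φ) (reflect A ξ ζ v) =
      reflect A ξ ζ (reflect A α φ v) := by
  rw [reflect, pairing_reflect_reflect h]
  simp only [reflect, pairing_sub_right, pairing_smul_right]
  module

/-- `α` is a root with coroot `φ`. -/
def IsBiroot (A : Matrix B B ℤ) (α φ : B → ℤ) : Prop :=
  ∃ (w : List B) (y : B), rootExpr A w y = α ∧ rootExpr A.transpose w y = φ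

theorem isBiroot_simpleRoot (A : Matrix B B ℤ) (y : B) :
    IsBiroot A (simpleRoot y) (simpleRoot y) := ⟨[], y, rfl, rfl⟩

theorem IsBiroot.isRoot {A : Matrix B B ℤ} {α φ : B → ℤ} (h : IsBiroot A α φ) : IsRoot A α := by
  obtain ⟨w, y, h, _⟩ := h; exact ⟨w, y, h⟩

theorem IsRoot.exists_isBiroot {A : Matrix B B ℤ} {α : B → ℤ} (h : IsRoot A α) :
    ∃ φ, IsBiroot A α φ := by
  obtain ⟨w, y, h⟩ := h; exact ⟨_, w, y, h, rfl⟩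

theorem IsBiroot.simpleReflection {A : Matrix B B ℤ} {α φ : B → ℤ} (h : IsBiroot A α φ) (y : B) :
    IsBiroot A (simpleReflection A y α) (simpleReflection A.transpose y φ) := by
  obtain ⟨w, z, rfl, rfl⟩ := h; exact ⟨y :: w, z, rfl, rfl⟩

theorem IsBiroot.transpose {A : Matrix B B ℤ} {α φ : B → ℤ} (h : IsBiroot A α φ) :
    IsBiroot A.transpose φ α := by
  obtain ⟨w, z, h1, h2⟩ := h; exact ⟨w, z, h2, by rwa [Matrix.transpose_transpose]⟩

/-- Induction over the expressions of a root together with its coroot. -/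
theorem IsBiroot.induction {A : Matrix B B ℤ} {P : (B → ℤ) → (B → ℤ) → Prop}
    (simple : ∀ y, P (simpleRoot y) (simpleRoot y))
    (step : ∀ α φ y, IsBiroot A α φ → P α φ →
      P (Stretch.simpleReflection A y α) (Stretch.simpleReflection A.transpose y φ))
    {α φ : B → ℤ} (h : IsBiroot A α φ) : P α φ := by
  obtain ⟨w, z, rfl, rfl⟩ := h
  induction w with
  | nil => exact simple z
  | cons y w ih => exact step _ _ y ⟨w, z, rfl, rfl⟩ ih

theorem IsGCM.pairing_self {A : Matrix B B ℤ} (hA : IsGCM A) {α φ : B → ℤ}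
    (h : IsBiroot A α φ) : pairing A φ α = 2 := by
  refine h.induction (P := fun α φ => pairing A φ α = 2) (fun y => ?_) fun α φ y _ h => ?_
  · rw [pairing_simpleRoot_simpleRoot, hA.diag]
  · rw [simpleReflection_eq_reflect, simpleReflection_eq_reflect, pairing_reflect_reflect _, h]
    rw [pairing_simpleRoot_simpleRoot, hA.diag]

theorem IsGCM.pairing_simple {A : Matrix B B ℤ} (hA : IsGCM A) (y : B) :
    pairing A (simpleRoot y) (simpleRoot y) = 2 := hA.pairing_self (isBiroot_simpleRoot A y)

/-- By induction on an expression for `ξ`, since the reflection in `s_y ξ` is the conjugate by `s_y`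
of the reflection in `ξ`. -/
theorem IsGCM.isBiroot_reflect {A : Matrix B B ℤ} (hA : IsGCM A) {ξ ζ : B → ℤ}
    (h : IsBiroot A ξ ζ) {α φ : B → ℤ} (h' : IsBiroot A α φ) :
    IsBiroot A (reflect A ξ ζ α) (reflect A.transpose ζ ξ φ) := by
  refine h.induction (P := fun ξ ζ => ∀ α φ, IsBiroot A α φ →
    IsBiroot A (reflect A ξ ζ α) (reflect A.transpose ζ ξ φ)) (fun y α φ h => ?_)
    (fun ξ ζ y _ ih α φ h => ?_) α φ h'
  · rw [← simpleReflection_eq_reflect, ← simpleReflection_eq_reflect]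
    exact h.simpleReflection y
  · have h2 := (ih _ _ (h.simpleReflection y)).simpleReflection y
    simp only [simpleReflection_eq_reflect] at h2 ⊢
    rw [← reflect_conj (hA.pairing_simple y), reflect_reflect (hA.pairing_simple y)] at h2
    have h3 := reflect_conj (hA.transpose.pairing_simple y) ζ ξ
      (reflect A.transpose (simpleRoot y) (simpleRoot y) φ)
    rw [Matrix.transpose_transpose, reflect_reflect (hA.transpose.pairing_simple y)] at h3
    rwa [← h3] at h2

theorem IsGCM.isRoot_reflect {A : Matrix B B ℤ} (hA : IsGCM A) {ξ ζ : B → ℤ}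
    (h : IsBiroot A ξ ζ) {α : B → ℤ} (h' : IsRoot A α) : IsRoot A (reflect A ξ ζ α) := by
  obtain ⟨φ, h'⟩ := h'.exists_isBiroot
  exact (hA.isBiroot_reflect h h').isRoot

theorem IsGCM.isRoot_reflect_iff {A : Matrix B B ℤ} (hA : IsGCM A) {ξ ζ : B → ℤ}
    (h : IsBiroot A ξ ζ) {α : B → ℤ} : IsRoot A (reflect A ξ ζ α) ↔ IsRoot A α := by
  refine ⟨fun h' => ?_, hA.isRoot_reflect h⟩
  simpa [reflect_reflect (hA.pairing_self h)] using hA.isRoot_reflect h h'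

theorem IsGCM.isBiroot_neg {A : Matrix B B ℤ} (hA : IsGCM A) {α φ : B → ℤ}
    (h : IsBiroot A α φ) : IsBiroot A (-α) (-φ) := by
  have := hA.isBiroot_reflect h h
  rwa [reflect_self (hA.pairing_self h), reflect_self (by
    rw [pairing_transpose, hA.pairing_self h])] at this

theorem IsGCM.isRoot_neg_iff {A : Matrix B B ℤ} (hA : IsGCM A) {α : B → ℤ} :
    IsRoot A (-α) ↔ IsRoot A α := by
  have key : ∀ {α}, IsRoot A α → IsRoot A (-α) := fun h => by
    obtain ⟨φ, h⟩ := h.exists_isBiroot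
    exact (hA.isBiroot_neg h).isRoot
  exact ⟨fun h => by simpa using key h, key⟩

theorem IsGCM.coherent {A : Matrix B B ℤ} (hA : IsGCM A) {α φ : B → ℤ} (h : IsBiroot A α φ) :
    (0 ≤ α ∧ 0 ≤ φ) ∨ (α ≤ 0 ∧ φ ≤ 0) := by
  obtain ⟨w, y, rfl, rfl⟩ := h; exact hA.sign_coherent w y

theorem IsGCM.nonneg_or_nonpos {A : Matrix B B ℤ} (hA : IsGCM A) {α : B → ℤ} (h : IsRoot A α) :
    0 ≤ α ∨ α ≤ 0 := by
  obtain ⟨φ, h⟩ := h.exists_isBiroot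
  exact (hA.coherent h).imp And.left And.left

theorem IsGCM.isRoot_ne_zero {A : Matrix B B ℤ} (hA : IsGCM A) {α : B → ℤ} (h : IsRoot A α) :
    α ≠ 0 := by
  rintro rfl
  obtain ⟨φ, h⟩ := h.exists_isBiroot
  simpa [pairing] using hA.pairing_self h

theorem IsGCM.not_nonpos {A : Matrix B B ℤ} (hA : IsGCM A) {α : B → ℤ} (h : IsRoot A α)
    (h0 : 0 ≤ α) : ¬ α ≤ 0 := fun h' => hA.isRoot_ne_zero h (le_antisymm h' h0)

theorem IsGCM.nonneg_iff {A : Matrix B B ℤ} (hA : IsGCM A) {α : B → ℤ} (h : IsRoot A α) :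
    0 ≤ α ↔ ¬ α ≤ 0 :=
  ⟨hA.not_nonpos h, fun h' => (hA.nonneg_or_nonpos h).resolve_right h'⟩

theorem IsGCM.nonneg_of_pos {A : Matrix B B ℤ} (hA : IsGCM A) {α : B → ℤ} (h : IsRoot A α)
    {z : B} (hz : 0 < α z) : 0 ≤ α :=
  (hA.nonneg_iff h).2 fun h' => absurd (h' z) (by simpa using hz)

theorem IsGCM.nonpos_of_neg {A : Matrix B B ℤ} (hA : IsGCM A) {α : B → ℤ} (h : IsRoot A α)
    {z : B} (hz : α z < 0) : α ≤ 0 :=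
  (hA.nonneg_or_nonpos h).resolve_left fun h' => absurd (h' z) (by simpa using hz)

/-- Roots are primitive vectors: reflecting back to a simple root preserves the divisor `k`, and a
simple root has a coordinate `1`. -/
theorem IsGCM.isUnit_of_isRoot_smul {A : Matrix B B ℤ} (hA : IsGCM A) {k : ℤ} {v : B → ℤ}
    (h : IsRoot A (k • v)) : IsUnit k := by
  obtain ⟨w, y, h⟩ := h
  induction w generalizing v with
  | nil =>
    have := congrFun h y
    simp only [rootExpr, simpleRoot, Pi.single_eq_same, Pi.smul_apply, smul_eq_mul] at this
    exact IsUnit.of_mul_eq_one _ this.symm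
  | cons z w ih =>
    refine ih (v := Stretch.simpleReflection A z v) ?_
    rw [← simpleReflection_smul, ← h, rootExpr, hA.simpleReflection_invol]

theorem IsGCM.eq_simpleRoot {A : Matrix B B ℤ} (hA : IsGCM A) {α : B → ℤ} (h : IsRoot A α)
    (h0 : 0 ≤ α) {y : B} (hy : ∀ z, z ≠ y → α z = 0) : α = simpleRoot y := by
  have h1 : α = α y • simpleRoot y := by
    ext z
    by_cases hz : z = y
    · subst hz; simp [simpleRoot]
    · simp [simpleRoot, hz, hy z hz]
  rw [h1] at h
  rcases Int.isUnit_iff.1 (hA.isUnit_of_isRoot_smul h) with h2 | h2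
  · rw [h1, h2, one_smul]
  · have := h0 y
    rw [h2] at this
    simp at this

theorem IsGCM.exists_pos_of_ne {A : Matrix B B ℤ} (hA : IsGCM A) {α : B → ℤ} (h : IsRoot A α)
    (h0 : 0 ≤ α) {y : B} (hy : α ≠ simpleRoot y) : ∃ z, z ≠ y ∧ 0 < α z := by
  by_contra! hc
  exact hy (hA.eq_simpleRoot h h0 fun z hz => le_antisymm (hc z hz) (h0 z))

theorem simpleReflection_apply_ne (A : Matrix B B ℤ) {y z : B} (h : z ≠ y) (v : B → ℤ) :
    simpleReflection A y v z = v z := by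
  simp [simpleReflection, simpleRoot, h]

theorem IsGCM.simpleReflection_nonneg {A : Matrix B B ℤ} (hA : IsGCM A) {α : B → ℤ}
    (h : IsRoot A α) (h0 : 0 ≤ α) {y : B} (hy : α ≠ simpleRoot y) :
    0 ≤ simpleReflection A y α := by
  obtain ⟨z, hz, hpos⟩ := hA.exists_pos_of_ne h h0 hy
  obtain ⟨φ, h⟩ := h.exists_isBiroot
  refine hA.nonneg_of_pos (h.simpleReflection y).isRoot (z := z) ?_
  rwa [simpleReflection_apply_ne A hz]

/-- A root determines its coroot. -/
theorem IsGCM.coroot_unique {A : Matrix B B ℤ} (hA : IsGCM A) {α φ φ' : B → ℤ}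
    (h : IsBiroot A α φ) (h' : IsBiroot A α φ') : φ = φ' := by
  refine h.induction (P := fun α φ => ∀ φ', IsBiroot A α φ' → φ = φ') (fun y φ' h' => ?_)
    (fun α φ y _ ih φ' h' => ?_) φ' h'
  · symm
    -- A coroot of `α_y` is nonnegative, and its reflection by `s_y`, a coroot of `-α_y`, is
    -- nonpositive. The reflection alters only the coordinate at `y`, so `φ'` is supported there.
    have h1 : 0 ≤ φ' := by
      rcases hA.coherent h' with h1 | h1
      · exact h1.2
      · exact absurd h1.1 (hA.not_nonpos (isBiroot_simpleRoot A y).isRoot (simpleRoot_nonneg y))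
    have h2 := h'.simpleReflection y
    rw [hA.simpleReflection_self] at h2
    have h3 : Stretch.simpleReflection A.transpose y φ' ≤ 0 := by
      rcases hA.coherent h2 with h3 | h3
      · exact absurd (neg_nonneg.1 h3.1)
          (hA.not_nonpos (isBiroot_simpleRoot A y).isRoot (simpleRoot_nonneg y))
      · exact h3.2
    refine hA.transpose.eq_simpleRoot h'.transpose.isRoot h1 fun z hz => le_antisymm ?_ (h1 z)
    have := h3 z
    rwa [simpleReflection_apply_ne _ hz] at this
  · have h2 := h'.simpleReflection y
    rw [hA.simpleReflection_invol] at h2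
    rw [ih _ h2, hA.transpose.simpleReflection_invol]

end Biroots

/-! ### Inversions of a root, descents and depth. -/

section Inversions

variable {B : Type*} [Fintype B] [DecidableEq B]

/-- The positive roots, other than `±α`, that the reflection attached to `α` makes negative. -/
def inv (A : Matrix B B ℤ) (α φ : B → ℤ) : Set (B → ℤ) :=
  {γ | IsRoot A γ ∧ 0 ≤ γ ∧ γ ≠ α ∧ γ ≠ -α ∧ reflect A α φ γ ≤ 0}

theorem IsGCM.neg_notMem_inv {A : Matrix B B ℤ} (hA : IsGCM A) {α φ ν : B → ℤ}
    (hν : IsRoot A ν) (h0 : 0 ≤ ν) : -ν ∉ inv A α φ :=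
  fun h => hA.not_nonpos hν h0 (neg_nonneg.1 h.2.1)

theorem IsGCM.reflect_notMem_inv {A : Matrix B B ℤ} (hA : IsGCM A) {α φ ν : B → ℤ}
    (hα : IsBiroot A α φ) (hν : IsRoot A ν) (h0 : 0 ≤ ν) : reflect A α φ ν ∉ inv A α φ :=
  fun h => hA.not_nonpos hν h0 (by simpa [reflect_reflect (hA.pairing_self hα)] using h.2.2.2.2)

/-- The map `γ ↦ -t_α γ` is an involution of the inversions; it pairs inversions that lie on
opposite sides of `α` in their common plane. -/
theorem IsGCM.neg_reflect_mem_inv {A : Matrix B B ℤ} (hA : IsGCM A) {α φ γ : B → ℤ}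
    (hα : IsBiroot A α φ) (h : γ ∈ inv A α φ) : -reflect A α φ γ ∈ inv A α φ := by
  obtain ⟨h1, h2, h3, h4, h5⟩ := h
  have hs := reflect_self (hA.pairing_self hα)
  have hr := reflect_reflect (hA.pairing_self hα)
  refine ⟨hA.isRoot_neg_iff.2 (hA.isRoot_reflect hα h1), neg_nonneg.2 h5, fun h => h3 ?_,
    fun h => h4 ?_, ?_⟩
  · have := congrArg (reflect A α φ) h
    rw [reflect_neg, hr, hs] at this
    exact neg_injective this
  · have := congrArg (reflect A α φ) h
    rw [reflect_neg, reflect_neg, hr, hs] at this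
    exact neg_injective this
  · rw [reflect_neg, hr]; exact neg_nonpos.2 h2

theorem IsGCM.neg_reflect_mem_inv_iff {A : Matrix B B ℤ} (hA : IsGCM A) {α φ γ : B → ℤ}
    (hα : IsBiroot A α φ) : -reflect A α φ γ ∈ inv A α φ ↔ γ ∈ inv A α φ := by
  refine ⟨fun h => ?_, hA.neg_reflect_mem_inv hα⟩
  simpa [reflect_neg, reflect_reflect (hA.pairing_self hα)] using hA.neg_reflect_mem_inv hα h

/-- At the vertex `z` the reflected root has the value `-⟨φ, ν⟩ α(z)`, and by sign coherence one
nonzero coordinate decides the sign of a root. -/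
theorem IsGCM.mem_inv_iff_pairing_pos {A : Matrix B B ℤ} (hA : IsGCM A) {α φ ν : B → ℤ}
    (hα : IsBiroot A α φ) (hν : IsRoot A ν) (h0 : 0 ≤ ν) {z : B} (hz : 0 < α z)
    (hνz : ν z = 0) : ν ∈ inv A α φ ↔ 0 < pairing A φ ν := by
  have hval : reflect A α φ ν z = -(pairing A φ ν * α z) := by simp [reflect, hνz]
  constructor
  · rintro ⟨-, -, -, -, h⟩
    have h1 := h z
    rw [hval] at h1
    have h2 : 0 ≤ pairing A φ ν := by
      by_contra hc
      have := mul_neg_of_neg_of_pos (not_le.1 hc) hz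
      simp at h1; omega
    refine lt_of_le_of_ne h2 fun hc => hA.not_nonpos hν h0 ?_
    simpa [reflect, ← hc] using h
  · intro h
    refine ⟨hν, h0, ?_, ?_, hA.nonpos_of_neg (hA.isRoot_reflect hα hν) (z := z) ?_⟩
    · rintro rfl; omega
    · rintro rfl; simp at hνz; omega
    · rw [hval]; have := mul_pos h hz; omega

/-- How inversion sets change under a reflection `t_ξ`: only the positive roots `ν` made negative
by `t_ξ`, their images under `t_α` and the negatives of these are exceptional. -/
theorem IsGCM.mem_inv_reflect {A : Matrix B B ℤ} (hA : IsGCM A) {ξ ζ α φ : B → ℤ}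
    (hξ : IsBiroot A ξ ζ) (hα : IsBiroot A α φ) (γ : B → ℤ) :
    (γ ∈ inv A α φ ↔
      reflect A ξ ζ γ ∈ inv A (reflect A ξ ζ α) (reflect A.transpose ζ ξ φ)) ∨
    ∃ ν, IsRoot A ν ∧ 0 ≤ ν ∧ reflect A ξ ζ ν ≤ 0 ∧
      (γ = ν ∨ γ = -ν ∨ γ = reflect A α φ ν ∨ γ = -reflect A α φ ν) := by
  by_cases hγ : IsRoot A γ
  swap
  · left
    refine iff_of_false (fun h => hγ h.1) fun h => hγ ?_
    exact (hA.isRoot_reflect_iff hξ).1 h.1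
  have hp := hA.pairing_self hξ
  have hrr := reflect_reflect (hA.pairing_self hα)
  -- Being an inversion depends on the signs of `γ` and `t_α γ`. After conjugation by `t_ξ` these
  -- become the signs of `t_ξ γ` and `t_ξ t_α γ`, so a discrepancy requires `t_ξ` to change the sign
  -- of `γ` or of `t_α γ`.
  have key : ∀ η, IsRoot A η → ¬ (η ≤ 0 ↔ reflect A ξ ζ η ≤ 0) →
      ∃ ν, IsRoot A ν ∧ 0 ≤ ν ∧ reflect A ξ ζ ν ≤ 0 ∧ (η = ν ∨ η = -ν) := fun η hη h => by
    rcases hA.nonneg_or_nonpos hη with h0 | h0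
    · have := hA.not_nonpos hη h0
      exact ⟨η, hη, h0, by tauto, Or.inl rfl⟩
    · have h1 : ¬ reflect A ξ ζ η ≤ 0 := by tauto
      have h2 := (hA.nonneg_iff (hA.isRoot_reflect hξ hη)).2 h1
      refine ⟨-η, hA.isRoot_neg_iff.2 hη, neg_nonneg.2 h0, ?_, Or.inr (neg_neg η).symm⟩
      rw [reflect_neg]; exact neg_nonpos.2 h2
  by_cases h1 : γ ≤ 0 ↔ reflect A ξ ζ γ ≤ 0
  swap
  · obtain ⟨ν, a, b, c, d⟩ := key γ hγ h1
    exact Or.inr ⟨ν, a, b, c, by tauto⟩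
  by_cases h2 : reflect A α φ γ ≤ 0 ↔ reflect A ξ ζ (reflect A α φ γ) ≤ 0
  swap
  · obtain ⟨ν, a, b, c, d⟩ := key _ (hA.isRoot_reflect hα hγ) h2
    refine Or.inr ⟨ν, a, b, c, Or.inr (Or.inr ?_)⟩
    rcases d with rfl | d
    · left; rw [hrr]
    · right; rw [← reflect_neg, ← d, hrr]
  left
  have hγ' := hA.isRoot_reflect hξ hγ
  have hinj : ∀ u v, reflect A ξ ζ u = reflect A ξ ζ v ↔ u = v := fun u v =>
    ⟨fun h => by simpa [reflect_reflect hp] using congrArg (reflect A ξ ζ) h, fun h => h ▸ rfl⟩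
  simp only [inv, Set.mem_ofPred_eq, reflect_conj hp, ← reflect_neg A ξ ζ α, hinj,
    hA.nonneg_iff hγ', hA.nonneg_iff hγ, ← h1, ← h2, hγ, hγ', true_and, ne_eq]

/-- The only positive root made negative by a simple reflection is the simple root. -/
theorem IsGCM.eq_simpleRoot_of_reflect_nonpos {A : Matrix B B ℤ} (hA : IsGCM A) {y : B}
    {φ ν : B → ℤ} (hν : IsRoot A ν) (h0 : 0 ≤ ν) (h : reflect A (simpleRoot y) φ ν ≤ 0) :
    ν = simpleRoot y := by
  refine hA.eq_simpleRoot hν h0 fun z hz => le_antisymm ?_ (h0 z)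
  simpa [reflect, simpleRoot, hz] using h z

theorem IsGCM.inv_simpleRoot {A : Matrix B B ℤ} (hA : IsGCM A) (y : B) (φ : B → ℤ) :
    inv A (simpleRoot y) φ = ∅ := by
  ext γ
  simp only [Set.mem_empty_iff_false, iff_false]
  rintro ⟨h1, h2, h3, -, h5⟩
  exact h3 (hA.eq_simpleRoot_of_reflect_nonpos h1 h2 h5)

theorem pairing_simpleReflection_simpleRoot {A : Matrix B B ℤ} (hA : IsGCM A) (φ : B → ℤ) (y : B) :
    pairing A (simpleReflection A.transpose y φ) (simpleRoot y) =
      -pairing A φ (simpleRoot y) := by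
  have := pairing_reflect_reflect (hA.pairing_simple y) φ (-simpleRoot y)
  rw [reflect_neg, reflect_self (hA.pairing_simple y), neg_neg, pairing_neg_right] at this
  rw [simpleReflection_eq_reflect, this]

theorem IsGCM.mem_inv_simpleReflection {A : Matrix B B ℤ} (hA : IsGCM A) {α φ : B → ℤ}
    (hα : IsBiroot A α φ) (y : B) (γ : B → ℤ) :
    (γ ∈ inv A α φ ↔ simpleReflection A y γ ∈
      inv A (simpleReflection A y α) (simpleReflection A.transpose y φ)) ∨
    γ = simpleRoot y ∨ γ = -simpleRoot y ∨ γ = reflect A α φ (simpleRoot y) ∨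
      γ = -reflect A α φ (simpleRoot y) := by
  simp only [simpleReflection_eq_reflect]
  refine (hA.mem_inv_reflect (isBiroot_simpleRoot A y) hα γ).imp_right ?_
  rintro ⟨ν, h1, h2, h3, h4⟩
  rwa [hA.eq_simpleRoot_of_reflect_nonpos h1 h2 h3] at h4

/-- Inversion sets along a descent. -/
theorem IsGCM.inv_eq_of_descent {A : Matrix B B ℤ} (hA : IsGCM A) {α φ : B → ℤ}
    (hα : IsBiroot A α φ) (h0 : 0 ≤ α) {y : B} (hy : α ≠ simpleRoot y)
    (hc : 0 < pairing A φ (simpleRoot y)) :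
    inv A α φ = {simpleRoot y, -reflect A α φ (simpleRoot y)} ∪
      simpleReflection A y ''
        inv A (simpleReflection A y α) (simpleReflection A.transpose y φ) ∧
    Disjoint {simpleRoot y, -reflect A α φ (simpleRoot y)} (simpleReflection A y ''
        inv A (simpleReflection A y α) (simpleReflection A.transpose y φ)) := by
  have hyr := (isBiroot_simpleRoot A y).isRoot
  have hy0 := simpleRoot_nonneg y
  obtain ⟨z, hz, hpos⟩ := hA.exists_pos_of_ne hα.isRoot h0 hy
  have hzy : simpleRoot y z = 0 := by simp [simpleRoot, hz]
  have hmem : simpleRoot y ∈ inv A α φ :=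
    (hA.mem_inv_iff_pairing_pos hα hyr hy0 hpos hzy).2 hc
  have hδ := hα.simpleReflection y
  set δ := simpleReflection A y α with hδdef
  set ψ := simpleReflection A.transpose y φ with hψdef
  -- The coroot of `s_y α` pairs with `α_y` with the opposite sign. Hence `α_y` and its partner are
  -- inversions of `α` but not of `s_y α`: the descent loses exactly these two.
  have hnot : simpleRoot y ∉ inv A δ ψ := fun h => by
    have := (hA.mem_inv_iff_pairing_pos hδ hyr hy0 (z := z)
      (by rwa [hδdef, simpleReflection_apply_ne A hz]) hzy).1 h
    rw [hψdef, pairing_simpleReflection_simpleRoot hA] at this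
    omega
  have hconj : ∀ v, simpleReflection A y (reflect A α φ v) =
      reflect A δ ψ (simpleReflection A y v) := fun v => by
    simp only [hδdef, hψdef, simpleReflection_eq_reflect, reflect_conj (hA.pairing_simple y)]
  have hr : simpleReflection A y (reflect A α φ (simpleRoot y)) =
      -reflect A δ ψ (simpleRoot y) := by
    rw [hconj, hA.simpleReflection_self, reflect_neg]
  have hiota : -reflect A δ ψ (simpleRoot y) ∉ inv A δ ψ := by
    rwa [hA.neg_reflect_mem_inv_iff hδ]
  have himg : ∀ γ, γ ∈ simpleReflection A y '' inv A δ ψ ↔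
      simpleReflection A y γ ∈ inv A δ ψ := fun γ =>
    ⟨by rintro ⟨γ', h, rfl⟩; rwa [hA.simpleReflection_invol],
      fun h => ⟨_, h, hA.simpleReflection_invol y γ⟩⟩
  have hd1 : simpleReflection A y (simpleRoot y) ∉ inv A δ ψ := by
    rw [hA.simpleReflection_self]; exact hA.neg_notMem_inv hyr hy0
  have hd2 : simpleReflection A y (-reflect A α φ (simpleRoot y)) ∉ inv A δ ψ := by
    rw [simpleReflection_neg, hr, neg_neg]; exact hA.reflect_notMem_inv hδ hyr hy0
  constructor
  · ext γ
    rw [Set.mem_union, himg]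
    simp only [Set.mem_insert_iff, Set.mem_singleton_iff]
    rcases hA.mem_inv_simpleReflection hα y γ with h | rfl | rfl | rfl | rfl
    · rw [h]
      refine ⟨Or.inr, ?_⟩
      rintro ((rfl | rfl) | h')
      · exact h.1 hmem
      · exact h.1 (hA.neg_reflect_mem_inv hα hmem)
      · exact h'
    · exact iff_of_true hmem (Or.inl (Or.inl rfl))
    · refine iff_of_false (hA.neg_notMem_inv hyr hy0) ?_
      rintro ((h | h) | h)
      · exact hA.not_nonpos hyr hy0 (by rw [← h]; simpa using hy0)
      · exact hA.neg_notMem_inv hyr hy0 (h ▸ hA.neg_reflect_mem_inv hα hmem)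
      · rw [simpleReflection_neg, hA.simpleReflection_self, neg_neg] at h
        exact hnot h
    · refine iff_of_false (hA.reflect_notMem_inv hα hyr hy0) ?_
      rintro ((h | h) | h)
      · exact hA.reflect_notMem_inv hα hyr hy0 (by rw [h]; exact hmem)
      · exact hA.reflect_notMem_inv hα hyr hy0 (h ▸ hA.neg_reflect_mem_inv hα hmem)
      · rw [hr] at h; exact hiota h
    · exact iff_of_true (hA.neg_reflect_mem_inv hα hmem) (Or.inl (Or.inr rfl))
  · rw [Set.disjoint_left]
    rintro γ (rfl | rfl) h
    · exact hd1 ((himg _).1 h)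
    · exact hd2 ((himg _).1 h)

/-- Holds whether or not `y` is a descent; it bounds the number of inversions by twice the length of
any expression. -/
theorem IsGCM.inv_subset {A : Matrix B B ℤ} (hA : IsGCM A) {α φ : B → ℤ}
    (hα : IsBiroot A α φ) (y : B) :
    inv A α φ ⊆ {simpleRoot y, -reflect A α φ (simpleRoot y)} ∪
      simpleReflection A y ''
        inv A (simpleReflection A y α) (simpleReflection A.transpose y φ) := by
  intro γ hγ
  have hyr := (isBiroot_simpleRoot A y).isRoot
  have hy0 := simpleRoot_nonneg y
  rcases hA.mem_inv_simpleReflection hα y γ with h | rfl | rfl | rfl | rfl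
  · exact Or.inr ⟨_, h.1 hγ, hA.simpleReflection_invol y γ⟩
  · exact Or.inl (Or.inl rfl)
  · exact absurd hγ (hA.neg_notMem_inv hyr hy0)
  · exact absurd hγ (hA.reflect_notMem_inv hα hyr hy0)
  · exact Or.inl (Or.inr rfl)

theorem IsGCM.inv_finite_and_card_le {A : Matrix B B ℤ} (hA : IsGCM A) (w : List B) (y : B) :
    (inv A (rootExpr A w y) (rootExpr A.transpose w y)).Finite ∧
      (inv A (rootExpr A w y) (rootExpr A.transpose w y)).ncard ≤ 2 * w.length := by
  induction w with
  | nil => simp [rootExpr, hA.inv_simpleRoot]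
  | cons z w ih =>
    have hsub := hA.inv_subset (α := rootExpr A (z :: w) y)
      (φ := rootExpr A.transpose (z :: w) y) ⟨z :: w, y, rfl, rfl⟩ z
    simp only [rootExpr, hA.simpleReflection_invol, hA.transpose.simpleReflection_invol] at hsub ⊢
    have hf := ih.1.image (simpleReflection A z)
    refine ⟨((Set.toFinite _).union hf).subset hsub, ?_⟩
    refine (Set.ncard_le_ncard hsub ((Set.toFinite _).union hf)).trans
      ((Set.ncard_union_le _ _).trans ?_)
    have h1 := Set.ncard_image_le ih.1 (f := simpleReflection A z)
    have h2 : ({simpleRoot z, -reflect A (simpleReflection A z (rootExpr A w y))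
      (simpleReflection A.transpose z (rootExpr A.transpose w y)) (simpleRoot z)} :
        Set (B → ℤ)).ncard ≤ 2 := (Set.ncard_insert_le _ _).trans (by rw [Set.ncard_singleton])
    rw [List.length_cons]
    omega

theorem IsGCM.inv_finite {A : Matrix B B ℤ} (hA : IsGCM A) {α φ : B → ℤ}
    (hα : IsBiroot A α φ) : (inv A α φ).Finite := by
  obtain ⟨w, y, rfl, rfl⟩ := hα; exact (hA.inv_finite_and_card_le w y).1

/-- Otherwise no term of `2 = ⟨φ, α⟩ = ∑ α(y) ⟨φ, α_y⟩` would be positive. -/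
theorem IsGCM.exists_descent {A : Matrix B B ℤ} (hA : IsGCM A) {α φ : B → ℤ}
    (hα : IsBiroot A α φ) (h0 : 0 ≤ α) : ∃ y, 0 < α y ∧ 0 < pairing A φ (simpleRoot y) := by
  by_contra! h
  have h1 := hA.pairing_self hα
  rw [pairing_eq_sum] at h1
  have : ∑ y, α y * pairing A φ (simpleRoot y) ≤ 0 := Finset.sum_nonpos fun y _ => by
    rcases (h0 y).eq_or_lt with h2 | h2
    · rw [← h2]; simp
    · exact mul_nonpos_of_nonneg_of_nonpos (h0 y) (h y h2)
  omega

theorem IsGCM.ncard_inv_of_descent {A : Matrix B B ℤ} (hA : IsGCM A) {α φ : B → ℤ}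
    (hα : IsBiroot A α φ) (h0 : 0 ≤ α) {y : B} (hy : α ≠ simpleRoot y)
    (hc : 0 < pairing A φ (simpleRoot y)) :
    (inv A α φ).ncard =
      (inv A (simpleReflection A y α) (simpleReflection A.transpose y φ)).ncard + 2 := by
  obtain ⟨h1, h2⟩ := hA.inv_eq_of_descent hα h0 hy hc
  have hinj : Function.Injective (simpleReflection A y) :=
    (Function.LeftInverse.injective (hA.simpleReflection_invol y))
  rw [h1, Set.ncard_union_eq h2 (Set.toFinite _)
    ((hA.inv_finite (hα.simpleReflection y)).image _), Set.ncard_image_of_injective _ hinj,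
    Set.ncard_pair, add_comm]
  intro h
  obtain ⟨z, hz, hpos⟩ := hA.exists_pos_of_ne hα.isRoot h0 hy
  have := congrFun h z
  simp only [reflect, simpleRoot, Pi.neg_apply, Pi.sub_apply, Pi.smul_apply, smul_eq_mul,
    Pi.single_apply, hz, if_false] at this
  have := mul_pos hc hpos
  simp only [simpleRoot] at this
  omega

/-- Induction over the positive roots along descents. -/
theorem IsGCM.descent_induction {A : Matrix B B ℤ} (hA : IsGCM A)
    {P : (B → ℤ) → (B → ℤ) → Prop} (simple : ∀ y, P (simpleRoot y) (simpleRoot y))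
    (step : ∀ α φ y, IsBiroot A α φ → 0 ≤ α → α ≠ simpleRoot y → 0 < α y →
      0 < pairing A φ (simpleRoot y) →
      P (simpleReflection A y α) (simpleReflection A.transpose y φ) → P α φ)
    {α φ : B → ℤ} (hα : IsBiroot A α φ) (h0 : 0 ≤ α) : P α φ := by
  induction hn : (inv A α φ).ncard using Nat.strong_induction_on generalizing α φ with
  | _ n ih =>
  subst hn
  obtain ⟨y, hy, hc⟩ := hA.exists_descent hα h0
  by_cases h : α = simpleRoot y
  · subst h
    rw [hA.coroot_unique hα (isBiroot_simpleRoot A y)]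
    exact simple y
  · refine step α φ y hα h0 h hy hc (ih _ ?_ (hα.simpleReflection y)
      (hA.simpleReflection_nonneg hα.isRoot h0 h) rfl)
    rw [hA.ncard_inv_of_descent hα h0 h hc]
    omega

theorem IsGCM.exists_expr {A : Matrix B B ℤ} (hA : IsGCM A) {α φ : B → ℤ}
    (hα : IsBiroot A α φ) (h0 : 0 ≤ α) :
    ∃ w y, rootExpr A w y = α ∧ (inv A α φ).ncard = 2 * w.length := by
  refine hA.descent_induction (P := fun α φ => ∃ w y, rootExpr A w y = α ∧
    (inv A α φ).ncard = 2 * w.length) (fun y => ⟨[], y, rfl, by simp [hA.inv_simpleRoot]⟩)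
    (fun α φ y hα h0 hy _ hc ⟨w, z, h1, h2⟩ => ⟨y :: w, z, ?_, ?_⟩) hα h0
  · rw [rootExpr, h1, hA.simpleReflection_invol]
  · rw [hA.ncard_inv_of_descent hα h0 hy hc, h2, List.length_cons]; ring

/-- Following descents down to a simple root gives an expression with exactly two inversions per
letter, and no expression has fewer letters because each adds at most two. -/
theorem IsGCM.ncard_inv_add_two {A : Matrix B B ℤ} (hA : IsGCM A) {α φ : B → ℤ}
    (hα : IsBiroot A α φ) (h0 : 0 ≤ α) : (inv A α φ).ncard + 2 = 2 * depth A α := by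
  obtain ⟨w, y, hw, hcard⟩ := hA.exists_expr hα h0
  have hle : depth A α ≤ w.length + 1 := Nat.sInf_le ⟨w, y, hw, rfl⟩
  obtain ⟨w', y', hw', h'⟩ := Nat.sInf_mem (s := {k | ∃ (w : List B) (y₀ : B),
    rootExpr A w y₀ = α ∧ k = w.length + 1}) ⟨_, w, y, hw, rfl⟩
  have h2 := (hA.inv_finite_and_card_le w' y').2
  rw [hw', hA.coroot_unique (φ := rootExpr A.transpose w' y') ⟨w', y', hw', rfl⟩ hα] at h2
  have h3 : depth A α = w'.length + 1 := h'
  omega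

end Inversions

/-! ### Rank 2 subarrangements and fractures in terms of inversions. -/

section Geometry

variable {B : Type*} [Fintype B] [DecidableEq B]

theorem mem_perp {v : B → ℝ} {φ : StrongDual ℝ (B → ℝ)} : φ ∈ perp v ↔ φ v = 0 := Iff.rfl

theorem perp_neg (v : B → ℝ) : perp (-v) = perp v := by
  ext φ; simp [mem_perp]

theorem toReal_neg (v : B → ℤ) : toReal (-v) = -toReal v := by
  ext; simp [toReal]

theorem toReal_sub (u v : B → ℤ) : toReal (u - v) = toReal u - toReal v := by
  ext; simp [toReal]

theorem toReal_smul (c : ℤ) (v : B → ℤ) : toReal (c • v) = (c : ℝ) • toReal v := by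
  ext; simp [toReal]

theorem toReal_injective : Function.Injective (toReal : (B → ℤ) → B → ℝ) := fun u v h => by
  ext y; simpa [toReal] using congrFun h y

theorem toReal_reflect (A : Matrix B B ℤ) (α φ v : B → ℤ) :
    toReal (reflect A α φ v) = toReal v - (pairing A φ v : ℝ) • toReal α := by
  rw [reflect, toReal_sub, toReal_smul]

/-- `c` lies in the span of `a` and `b`. -/
def InPlane (a b c : B → ℝ) : Prop := ∃ x y : ℝ, c = x • a + y • b

theorem inPlane_left (a b : B → ℝ) : InPlane a b a := ⟨1, 0, by simp⟩

theorem inPlane_right (a b : B → ℝ) : InPlane a b b := ⟨0, 1, by simp⟩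

theorem perp_inf_le_iff (a b c : B → ℝ) : perp a ⊓ perp b ≤ perp c ↔ InPlane a b c := by
  constructor
  · intro h
    by_contra hc
    have hnot : c ∉ Submodule.span ℝ {a, b} := fun hm => by
      obtain ⟨x, y, hxy⟩ := Submodule.mem_span_pair.1 hm
      exact hc ⟨x, y, hxy.symm⟩
    obtain ⟨f, hf, hle⟩ := Submodule.exists_le_ker_of_notMem hnot
    refine hf (h (x := LinearMap.toContinuousLinearMap f) ⟨?_, ?_⟩)
    · exact hle (Submodule.subset_span (by simp))
    · exact hle (Submodule.subset_span (by simp))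
  · rintro ⟨x, y, rfl⟩ φ ⟨h1, h2⟩
    have h1 : φ a = 0 := h1
    have h2 : φ b = 0 := h2
    simp [mem_perp, h1, h2]

/-- The sum of the coordinates of a vector, with the coordinates weighted by `c`. -/
noncomputable def weightFunctional (c : B → ℝ) : StrongDual ℝ (B → ℝ) :=
  ∑ z, c z • ContinuousLinearMap.proj z

theorem weightFunctional_apply (c v : B → ℝ) : weightFunctional c v = ∑ z, c z * v z := by
  simp [weightFunctional]

theorem apply_toReal (d : StrongDual ℝ (B → ℝ)) (γ : B → ℤ) :
    d (toReal γ) = ∑ y, (γ y : ℝ) * d (toReal (simpleRoot y)) := by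
  have : toReal γ = ∑ y, (γ y : ℝ) • toReal (simpleRoot y) := by
    ext z
    simp [toReal, simpleRoot, Pi.single_apply]
  conv_lhs => rw [this]
  simp [map_sum]

theorem exists_mem_baseRegion : ∃ d, d ∈ baseRegion B := by
  refine ⟨weightFunctional fun _ => 1, fun y => ?_⟩
  rw [weightFunctional_apply]
  simp [toReal, simpleRoot, Pi.single_apply]

theorem IsGCM.exists_coord_pos {A : Matrix B B ℤ} (hA : IsGCM A) {γ : B → ℤ} (h : IsRoot A γ)
    (h0 : 0 ≤ γ) : ∃ z, 0 < γ z := by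
  by_contra! hc
  exact hA.not_nonpos h h0 hc

theorem IsGCM.pos_of_mem_baseRegion {A : Matrix B B ℤ} (hA : IsGCM A)
    {d : StrongDual ℝ (B → ℝ)} (hd : d ∈ baseRegion B) {γ : B → ℤ} (h : IsRoot A γ)
    (h0 : 0 ≤ γ) : 0 < d (toReal γ) := by
  rw [apply_toReal]
  obtain ⟨z, hz⟩ := hA.exists_coord_pos h h0
  refine Finset.sum_pos' (fun y _ => mul_nonneg (by exact_mod_cast h0 y) (hd y).le)
    ⟨z, Finset.mem_univ z, mul_pos (by exact_mod_cast hz) (hd z)⟩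

/-- The positive roots in the span of `a` and `b`. -/
def planeRoots (A : Matrix B B ℤ) (a b : B → ℤ) : Set (B → ℤ) :=
  {γ | IsRoot A γ ∧ 0 ≤ γ ∧ InPlane (toReal a) (toReal b) (toReal γ)}

/-- Positive roots are positive on `D`, so a segment from `D` meets the hyperplane of one unless its
other end is also on the positive side. The generating pair enters only through its intersection,
which permits exchanging the two hyperplanes or replacing one by another of the same plane. -/
theorem IsGCM.regionContainingBase_eq {A : Matrix B B ℤ} (hA : IsGCM A) {a b : B → ℤ}
    {K₁ K₂ : Submodule ℝ (StrongDual ℝ (B → ℝ))}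
    (hK : K₁ ⊓ K₂ = perp (toReal a) ⊓ perp (toReal b)) :
    regionContainingBase (rankTwoSubarrangement A K₁ K₂) =
      {φ | ∀ γ ∈ planeRoots A a b, 0 < φ (toReal γ)} := by
  ext φ
  constructor
  · intro hφ γ hγ
    obtain ⟨h1, h2, h3⟩ := hγ
    obtain ⟨d, hd⟩ := exists_mem_baseRegion (B := B)
    by_contra hneg
    have hdpos := hA.pos_of_mem_baseRegion hd h1 h2
    have hdis := hφ (perp (toReal γ)) ⟨⟨γ, h1, rfl⟩, by rw [hK, perp_inf_le_iff]; exact h3⟩ d hd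
    set p := d (toReal γ)
    set q := φ (toReal γ) with hq
    have hpq : 0 < p - q := by linarith
    refine Set.disjoint_left.1 hdis
      (?_ : (1 - p / (p - q)) • d + (p / (p - q)) • φ ∈ segment ℝ d φ) ?_
    · rw [segment_eq_image]
      -- The zero of the affine function going from `p > 0` to `q ≤ 0` along the segment.
      exact ⟨p / (p - q), ⟨by positivity, by rw [div_le_one hpq]; linarith⟩, rfl⟩
    · change ((1 - p / (p - q)) • d + (p / (p - q)) • φ) (toReal γ) = 0
      simp only [add_apply, smul_apply, smul_eq_mul]
      change (1 - p / (p - q)) * p + p / (p - q) * q = 0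
      field_simp
      ring
  · rintro hφ H ⟨⟨γ, hγ, rfl⟩, hle⟩ d hd
    rw [hK, perp_inf_le_iff] at hle
    have key : ∀ γ' : B → ℤ, IsRoot A γ' → 0 ≤ γ' →
        InPlane (toReal a) (toReal b) (toReal γ') →
        Disjoint (segment ℝ d φ) (perp (toReal γ') : Set (StrongDual ℝ (B → ℝ))) := by
      intro γ' h1 h2 h3
      rw [Set.disjoint_left]
      rintro x ⟨s, t, hs, ht, hst, rfl⟩ hx
      have hx : (s • d + t • φ) (toReal γ') = 0 := hx
      simp only [add_apply, smul_apply, smul_eq_mul] at hx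
      have e1 := hA.pos_of_mem_baseRegion hd h1 h2
      have e2 := hφ γ' ⟨h1, h2, h3⟩
      rcases hs.eq_or_lt with h | h
      · have : t = 1 := by linarith
        rw [← h, this] at hx
        linarith
      · have := mul_pos h e1
        have := mul_nonneg ht e2.le
        linarith
    rcases hA.nonneg_or_nonpos hγ with h | h
    · exact key γ hγ h hle
    · have := key (-γ) (hA.isRoot_neg_iff.2 hγ) (neg_nonneg.2 h) (by
        obtain ⟨x, y, hxy⟩ := hle
        refine ⟨-x, -y, ?_⟩
        rw [toReal_neg, hxy]; module)
      rwa [toReal_neg, perp_neg] at this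

theorem IsGCM.closure_regionContainingBase {A : Matrix B B ℤ} (hA : IsGCM A) {a b : B → ℤ}
    {K₁ K₂ : Submodule ℝ (StrongDual ℝ (B → ℝ))}
    (hK : K₁ ⊓ K₂ = perp (toReal a) ⊓ perp (toReal b)) :
    closure (regionContainingBase (rankTwoSubarrangement A K₁ K₂)) =
      {φ | ∀ γ ∈ planeRoots A a b, 0 ≤ φ (toReal γ)} := by
  rw [hA.regionContainingBase_eq hK]
  apply subset_antisymm
  · refine closure_minimal (fun φ h γ hγ => (h γ hγ).le) ?_
    have : {φ : StrongDual ℝ (B → ℝ) | ∀ γ ∈ planeRoots A a b, 0 ≤ φ (toReal γ)} =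
        ⋂ γ ∈ planeRoots A a b, {φ | 0 ≤ φ (toReal γ)} := by
      ext; simp
    rw [this]
    refine isClosed_biInter fun γ _ => isClosed_le continuous_const ?_
    exact (ContinuousLinearMap.apply ℝ ℝ (toReal γ)).continuous
  · intro φ hφ
    obtain ⟨d, hd⟩ := exists_mem_baseRegion (B := B)
    have hlim : Filter.Tendsto (fun ε : ℝ => φ + ε • d) (nhdsWithin 0 (Set.Ioi 0)) (nhds φ) := by
      have hc : Continuous fun ε : ℝ => φ + ε • d := by fun_prop
      have := hc.tendsto 0
      simp only [zero_smul, add_zero] at this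
      exact this.mono_left nhdsWithin_le_nhds
    refine mem_closure_of_tendsto hlim ?_
    filter_upwards [self_mem_nhdsWithin] with ε hε γ hγ
    have := mul_pos hε (hA.pos_of_mem_baseRegion hd hγ.1 hγ.2.1)
    have := hφ γ hγ
    simp only [add_apply, smul_apply, smul_eq_mul]
    linarith

theorem IsGCM.toReal_ne_zero {A : Matrix B B ℤ} (hA : IsGCM A) {γ : B → ℤ} (h : IsRoot A γ) :
    toReal γ ≠ 0 := fun h0 => hA.isRoot_ne_zero h (toReal_injective (by
      rw [h0]; ext; simp [toReal]))

theorem IsGCM.perp_eq_of_le {A : Matrix B B ℤ} (hA : IsGCM A) {a b : B → ℤ} (hb : IsRoot A b)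
    (h : perp (toReal a) ≤ perp (toReal b)) : perp (toReal a) = perp (toReal b) := by
  obtain ⟨x, y, hxy⟩ := (perp_inf_le_iff _ (toReal a) _).1 (inf_le_left.trans h)
  rw [← add_smul] at hxy
  refine le_antisymm h fun φ hφ => ?_
  rw [mem_perp] at hφ ⊢
  rw [hxy, map_smul, smul_eq_mul] at hφ
  refine (mul_eq_zero.1 hφ).resolve_left fun h0 => hA.toReal_ne_zero hb ?_
  rw [hxy, h0, zero_smul]

/-- The closed region is stable under adding functionals that vanish on the plane, and these have
codimension one in `a^⊥`. So the face in `a^⊥` spans it as soon as it contains one point not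
vanishing on `b`. -/
theorem IsGCM.isBasic_iff {A : Matrix B B ℤ} (hA : IsGCM A) {a b : B → ℤ}
    {K₁ K₂ : Submodule ℝ (StrongDual ℝ (B → ℝ))}
    (hK : K₁ ⊓ K₂ = perp (toReal a) ⊓ perp (toReal b)) (ha : IsRoot A a) (hb : IsRoot A b)
    (hab : perp (toReal a) ≠ perp (toReal b)) :
    IsBasic (rankTwoSubarrangement A K₁ K₂) (perp (toReal a)) ↔
      ∃ φ : StrongDual ℝ (B → ℝ), φ (toReal a) = 0 ∧ φ (toReal b) ≠ 0 ∧
        ∀ γ ∈ planeRoots A a b, 0 ≤ φ (toReal γ) := by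
  rw [IsBasic, hA.closure_regionContainingBase hK]
  constructor
  · rintro ⟨-, hspan⟩
    by_contra! hc
    refine hab (hA.perp_eq_of_le hb ?_)
    rw [← hspan, Submodule.span_le]
    rintro φ ⟨h1, h2⟩
    by_contra h3
    obtain ⟨γ, hγ, hneg⟩ := hc φ h2 h3
    exact absurd (h1 γ hγ) (not_le.2 hneg)
  · rintro ⟨φ, h1, h2, h3⟩
    refine ⟨⟨⟨a, ha, rfl⟩, hK ▸ inf_le_left⟩, le_antisymm (Submodule.span_le.2 fun ψ h => h.2) ?_⟩
    intro h hh
    have hh : h (toReal a) = 0 := hh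
    set c := h (toReal b) / φ (toReal b) with hc
    have hdec : h = (h - c • φ) + c • φ := by abel
    rw [hdec]
    refine Submodule.add_mem _ (Submodule.subset_span ⟨?_, ?_⟩)
      (Submodule.smul_mem _ _ (Submodule.subset_span ⟨h3, h1⟩))
    · rintro γ ⟨-, -, x, y, hxy⟩
      rw [hxy]
      have : (h - c • φ) (toReal b) = 0 := by
        simp only [sub_apply, smul_apply, smul_eq_mul, hc]
        field_simp
        ring
      rw [map_add, map_smul, map_smul, this]
      simp [hh, h1]
    · change (h - c • φ) (toReal a) = 0
      simp [hh, h1]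

/-- The real extension of a simple reflection. -/
noncomputable def realReflection (A : Matrix B B ℤ) (y : B) : (B → ℝ) →L[ℝ] (B → ℝ) :=
  ContinuousLinearMap.id ℝ _ -
    (weightFunctional fun z => (A y z : ℝ)).smulRight (toReal (simpleRoot y))

theorem realReflection_toReal (A : Matrix B B ℤ) (y : B) (v : B → ℤ) :
    realReflection A y (toReal v) = toReal (simpleReflection A y v) := by
  rw [simpleReflection, toReal_sub, toReal_smul, realReflection]
  simp [weightFunctional_apply, toReal]

theorem InPlane.simpleReflection {A : Matrix B B ℤ} {a b c : B → ℤ}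
    (h : InPlane (toReal a) (toReal b) (toReal c)) (y : B) :
    InPlane (toReal (simpleReflection A y a)) (toReal (simpleReflection A y b))
      (toReal (simpleReflection A y c)) := by
  obtain ⟨s, t, h⟩ := h
  refine ⟨s, t, ?_⟩
  rw [← realReflection_toReal, h, map_add, map_smul, map_smul, realReflection_toReal,
    realReflection_toReal]

/-- Every plane spanned by a root and one of its inversions contains an extremal positive root. -/
theorem IsGCM.exists_extremal {A : Matrix B B ℤ} (hA : IsGCM A) {α φ : B → ℤ}
    (hα : IsBiroot A α φ) (h0 : 0 ≤ α) {γ : B → ℤ} (hγ : γ ∈ inv A α φ) :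
    ∃ γ₁ ∈ planeRoots A α γ, ∃ ψ : StrongDual ℝ (B → ℝ), ψ (toReal γ₁) = 0 ∧
      ψ (toReal α) ≠ 0 ∧ ∀ δ ∈ planeRoots A α γ, 0 ≤ ψ (toReal δ) := by
  refine hA.descent_induction (P := fun α φ => ∀ γ ∈ inv A α φ,
    ∃ γ₁ ∈ planeRoots A α γ, ∃ ψ : StrongDual ℝ (B → ℝ), ψ (toReal γ₁) = 0 ∧
      ψ (toReal α) ≠ 0 ∧ ∀ δ ∈ planeRoots A α γ, 0 ≤ ψ (toReal δ))
    (fun y γ h => by simp [hA.inv_simpleRoot] at h) ?_ hα h0 γ hγ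
  intro α φ y hα h0 hy _ hc ih γ hγ
  -- If `α_y` lies in the plane it is itself extremal, as witnessed by the sum of all coordinates
  -- other than that at `y`. If not, `s_y` keeps all positive roots of the plane positive, and the
  -- extremal root is transported from the plane of `s_y α`.
  by_cases hplane : InPlane (toReal α) (toReal γ) (toReal (simpleRoot y))
  · refine ⟨simpleRoot y, ⟨(isBiroot_simpleRoot A y).isRoot, simpleRoot_nonneg y, hplane⟩,
      weightFunctional fun z => if z = y then 0 else 1, ?_, ?_, fun δ hδ => ?_⟩
    · rw [weightFunctional_apply]
      refine Finset.sum_eq_zero fun z _ => ?_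
      by_cases h : z = y <;> simp [toReal, simpleRoot, h]
    · rw [weightFunctional_apply]
      obtain ⟨z, hz, hpos⟩ := hA.exists_pos_of_ne hα.isRoot h0 hy
      refine (Finset.sum_pos' (fun w _ => ?_) ⟨z, Finset.mem_univ z, ?_⟩).ne'
      · have := h0 w
        simp only [toReal]
        split_ifs <;> simp_all
      · simpa [hz, toReal] using hpos
    · rw [weightFunctional_apply]
      refine Finset.sum_nonneg fun w _ => ?_
      have := hδ.2.1 w
      simp only [toReal]
      split_ifs <;> simp_all
  · obtain ⟨γ', hγ', rfl⟩ : γ ∈ simpleReflection A y ''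
        inv A (simpleReflection A y α) (simpleReflection A.transpose y φ) := by
      rw [(hA.inv_eq_of_descent hα h0 hy hc).1] at hγ
      rcases hγ with (rfl | rfl) | h
      · exact absurd (inPlane_right _ _) hplane
      · refine absurd ⟨pairing A φ (simpleRoot y), -1, ?_⟩ hplane
        rw [toReal_neg, toReal_reflect]; module
      · exact h
    obtain ⟨γ₁, ⟨h1, h2, h3⟩, ψ, h4, h5, h6⟩ := ih γ' hγ'
    have h3' := h3.simpleReflection (A := A) y
    rw [hA.simpleReflection_invol] at h3'
    have hne : γ₁ ≠ simpleRoot y := by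
      rintro rfl
      rw [hA.simpleReflection_self, toReal_neg] at h3'
      obtain ⟨s, t, hst⟩ := h3'
      refine hplane ⟨-s, -t, ?_⟩
      rw [← neg_neg (toReal (simpleRoot y)), hst]; module
    have hr : ∀ {η}, IsRoot A η → IsRoot A (simpleReflection A y η) := fun h => by
      rw [simpleReflection_eq_reflect]; exact hA.isRoot_reflect (isBiroot_simpleRoot A y) h
    refine ⟨simpleReflection A y γ₁, ⟨hr h1, hA.simpleReflection_nonneg h1 h2 hne, h3'⟩,
      ψ.comp (realReflection A y), ?_, ?_, ?_⟩
    · rw [ContinuousLinearMap.comp_apply, realReflection_toReal, hA.simpleReflection_invol, h4]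
    · rwa [ContinuousLinearMap.comp_apply, realReflection_toReal]
    · rintro η ⟨e1, e2, e3⟩
      rw [ContinuousLinearMap.comp_apply, realReflection_toReal]
      have hne' : η ≠ simpleRoot y := by rintro rfl; exact hplane e3
      have e4 := e3.simpleReflection (A := A) y
      rw [hA.simpleReflection_invol] at e4
      exact h6 _ ⟨hr e1, hA.simpleReflection_nonneg e1 e2 hne', e4⟩

/-- The fractures of `α^⊥` are its intersections with the hyperplanes of the inversions of `α`. -/
theorem IsGCM.fractures_eq {A : Matrix B B ℤ} (hA : IsGCM A) {α φ : B → ℤ}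
    (hα : IsBiroot A α φ) (h0 : 0 ≤ α) :
    fractures A (perp (toReal α)) =
      {F | ∃ γ ∈ inv A α φ, F = perp (toReal γ) ⊓ perp (toReal α)} := by
  have hpair : ∀ {a b : B → ℤ} {x y : ℝ}, toReal a = x • toReal α + y • toReal b →
      (pairing A φ a : ℝ) = x * 2 + y * pairing A φ b := by
    intro a b x y h
    have hval : ∀ v : B → ℤ, (pairing A φ v : ℝ) =
        weightFunctional (fun z => (pairing A φ (simpleRoot z) : ℝ)) (toReal v) := fun v => by
      rw [pairing_eq_sum, weightFunctional_apply]
      push_cast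
      exact Finset.sum_congr rfl fun z _ => mul_comm _ _
    have h2 : (pairing A φ α : ℝ) = 2 := by exact_mod_cast hA.pairing_self hα
    rw [hval a, h, map_add, map_smul, map_smul, ← hval, ← hval, h2, smul_eq_mul, smul_eq_mul]
  ext F
  constructor
  · rintro ⟨H₁, ⟨⟨γ₀, hγ₀, rfl⟩, -, hne, hb, hnb⟩, rfl⟩
    obtain ⟨γ₁, h1, h2, hperp⟩ : ∃ γ₁, IsRoot A γ₁ ∧ 0 ≤ γ₁ ∧
        perp (toReal γ₀) = perp (toReal γ₁) := by
      rcases hA.nonneg_or_nonpos hγ₀ with h | h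
      · exact ⟨γ₀, hγ₀, h, rfl⟩
      · exact ⟨-γ₀, hA.isRoot_neg_iff.2 hγ₀, neg_nonneg.2 h, by rw [toReal_neg, perp_neg]⟩
    rw [hperp] at hne hb hnb ⊢
    rw [hA.isBasic_iff rfl h1 hα.isRoot hne] at hb
    rw [hA.isBasic_iff (inf_comm _ _) hα.isRoot h1 hne.symm] at hnb
    obtain ⟨ψ, hψ1, hψα, hψ⟩ := hb
    have hcomm : ∀ γ, γ ∈ planeRoots A α γ₁ → γ ∈ planeRoots A γ₁ α :=
      fun γ ⟨a, b, x, y, h⟩ => ⟨a, b, y, x, by rw [h, add_comm]⟩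
    have hψα' : 0 < ψ (toReal α) :=
      lt_of_le_of_ne (hψ α (hcomm α ⟨hα.isRoot, h0, inPlane_left _ _⟩)) (Ne.symm hψα)
    -- a functional vanishing on `α` and positive on `γ₁`
    obtain ⟨χ, hχα, hχ1⟩ : ∃ χ : StrongDual ℝ (B → ℝ), χ (toReal α) = 0 ∧
        χ (toReal γ₁) ≠ 0 := by
      by_contra! hc
      exact hne.symm (hA.perp_eq_of_le h1 fun χ h => hc χ h)
    wlog hχpos : 0 < χ (toReal γ₁) generalizing χ
    · exact this (-χ) (by simp [hχα]) (by simpa using hχ1)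
        (by simpa using lt_of_le_of_ne (not_lt.1 hχpos) hχ1)
    -- As `α^⊥` is not basic, some positive root of the plane lies on the side of `α` opposite to
    -- `γ₁`.
    obtain ⟨δ, ⟨hδr, hδ0, x, y, hxy⟩, hδneg⟩ : ∃ δ ∈ planeRoots A α γ₁, χ (toReal δ) < 0 := by
      by_contra! hc
      exact hnb ⟨χ, hχα, hχ1, hc⟩
    have hy : ∀ {δ : B → ℤ} {x y : ℝ}, toReal δ = x • toReal α + y • toReal γ₁ →
        χ (toReal δ) = y * χ (toReal γ₁) := fun h => by
      rw [h, map_add, map_smul, map_smul, hχα]; simp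
    suffices h : ∃ γ ∈ inv A α φ, InPlane (toReal α) (toReal γ₁) (toReal γ) ∧
        χ (toReal γ) ≠ 0 by
      obtain ⟨γ, hγ, ⟨s, t, hst⟩, hγχ⟩ := h
      refine ⟨γ, hγ, le_antisymm (le_inf ?_ inf_le_right) (le_inf ?_ inf_le_right)⟩
      · rw [perp_inf_le_iff]; exact ⟨t, s, by rw [hst, add_comm]⟩
      · rw [perp_inf_le_iff]
        have ht : t ≠ 0 := by rintro rfl; exact hγχ (by rw [hy hst, zero_mul])
        refine ⟨t⁻¹, -(t⁻¹ * s), ?_⟩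
        rw [hst, smul_add, smul_smul, smul_smul, inv_mul_cancel₀ ht]; module
    have hneα : ∀ γ, χ (toReal γ) ≠ 0 → γ ≠ α ∧ γ ≠ -α := fun γ h =>
      ⟨by rintro rfl; exact h hχα, by rintro rfl; exact h (by rw [toReal_neg, map_neg, hχα, neg_zero])⟩
    -- If `⟨φ, γ₁⟩ > 0`, then `t_α γ₁` falls beyond the extremal root `γ₁`, so it is negative and
    -- `γ₁` is an inversion. Otherwise every positive root beyond `α` pairs positively with `φ`; `δ`
    -- and `t_α δ` have opposite pairings and lie on the same side, so `t_α δ` must be negative and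
    -- `δ` is an inversion.
    by_cases hp1 : 0 < pairing A φ γ₁
    · refine ⟨γ₁, ⟨h1, h2, (hneα _ hχ1).1, (hneα _ hχ1).2, ?_⟩, inPlane_right _ _, hχ1⟩
      by_contra hpos
      have hr := hA.isRoot_reflect hα h1
      have := hψ (reflect A α φ γ₁) ⟨hr, (hA.nonneg_iff hr).2 hpos, 1, -(pairing A φ γ₁ : ℝ), by
        rw [toReal_reflect]; module⟩
      rw [toReal_reflect, map_sub, map_smul, hψ1, smul_eq_mul] at this
      have h3 : 0 < (pairing A φ γ₁ : ℝ) := by exact_mod_cast hp1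
      have := mul_pos h3 hψα'
      linarith
    · have hall : ∀ δ : B → ℤ, IsRoot A δ → 0 ≤ δ → ∀ x y : ℝ,
          toReal δ = x • toReal α + y • toReal γ₁ → χ (toReal δ) < 0 →
          0 < pairing A φ δ := by
        intro δ hδr hδ0 x y hxy hneg
        have hyneg : y < 0 := by
          rw [hy hxy] at hneg; nlinarith
        have hxpos : 0 < x := by
          obtain ⟨z, hz⟩ := hA.exists_coord_pos hδr hδ0
          have e := congrFun hxy z
          simp only [toReal, Pi.add_apply, Pi.smul_apply, smul_eq_mul] at e
          have e1 : (0 : ℝ) < δ z := by exact_mod_cast hz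
          have e2 : (0 : ℝ) ≤ γ₁ z := by exact_mod_cast h2 z
          have e3 : (0 : ℝ) ≤ α z := by exact_mod_cast h0 z
          by_contra hx
          have := mul_nonneg (neg_nonneg.2 (not_lt.1 hx)) e3
          have := mul_nonneg (neg_nonneg.2 hyneg.le) e2
          linarith
        have e := hpair hxy
        have e1 : (pairing A φ γ₁ : ℝ) ≤ 0 := by exact_mod_cast not_lt.1 hp1
        have := mul_nonneg_of_nonpos_of_nonpos hyneg.le e1
        have : (0 : ℝ) < pairing A φ δ := by linarith
        exact_mod_cast this
      refine ⟨δ, ⟨hδr, hδ0, (hneα _ hδneg.ne).1, (hneα _ hδneg.ne).2, ?_⟩, ⟨x, y, hxy⟩,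
        hδneg.ne⟩
      by_contra hpos
      have hr := hA.isRoot_reflect hα hδr
      have hp := hall δ hδr hδ0 x y hxy hδneg
      have hp' := hall _ hr ((hA.nonneg_iff hr).2 hpos) (x - pairing A φ δ) y
        (by rw [toReal_reflect, hxy]; module)
        (by rw [toReal_reflect, map_sub, map_smul, hχα]; simpa using hδneg)
      rw [reflect, pairing_sub_right, pairing_smul_right, hA.pairing_self hα] at hp'
      omega
  · rintro ⟨γ, hγ, rfl⟩
    obtain ⟨γ₁, ⟨h1, h2, s, t, hst⟩, ψ, hψ1, hψα, hψ⟩ := hA.exists_extremal hα h0 hγ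
    have ht : t ≠ 0 := by
      rintro rfl
      have h3 := hψ1
      rw [hst, map_add, map_smul, map_smul, zero_smul, add_zero, smul_eq_mul] at h3
      refine hA.toReal_ne_zero h1 ?_
      rw [hst, (mul_eq_zero.1 h3).resolve_right hψα]; simp
    have hγ1 : toReal γ = t⁻¹ • toReal γ₁ + (-(t⁻¹ * s)) • toReal α := by
      rw [hst, smul_add, smul_smul, smul_smul, inv_mul_cancel₀ ht]; module
    have hK : perp (toReal γ₁) ⊓ perp (toReal α) = perp (toReal γ) ⊓ perp (toReal α) :=
      le_antisymm (le_inf ((perp_inf_le_iff _ _ _).2 ⟨_, _, hγ1⟩) inf_le_right)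
        (le_inf ((perp_inf_le_iff _ _ _).2 ⟨t, s, by rw [hst, add_comm]⟩) inf_le_right)
    have hne : perp (toReal γ₁) ≠ perp (toReal α) := fun h => hψα (by
      have : ψ ∈ perp (toReal γ₁) := hψ1
      rwa [h] at this)
    have hγα : perp (toReal α) ≠ perp (toReal γ) := fun h => by
      have h3 : perp (toReal γ₁) = perp (toReal α) := by
        refine (hA.perp_eq_of_le h1 ?_).symm
        rw [← h, inf_idem] at hK
        rw [← hK]; exact inf_le_left
      exact hne h3
    refine ⟨perp (toReal γ₁), ⟨⟨γ₁, h1, rfl⟩, ⟨α, hα.isRoot, rfl⟩, hne, ?_, ?_⟩, hK.symm⟩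
    · rw [hA.isBasic_iff rfl h1 hα.isRoot hne]
      refine ⟨ψ, hψ1, hψα, fun δ ⟨e1, e2, x, y, e3⟩ => hψ δ ⟨e1, e2, y + x * s, x * t, ?_⟩⟩
      rw [e3, hst]; module
    -- A functional vanishing on `α` takes opposite values on `γ` and on its partner `-t_α γ`. Both
    -- are positive roots, so it cannot be nonnegative on the plane roots without vanishing on `γ`.
    · rw [hA.isBasic_iff (hK.trans (inf_comm _ _)) hα.isRoot hγ.1 hγα]
      rintro ⟨χ, hχα, hχγ, hχ⟩
      have e1 := hχ γ ⟨hγ.1, hγ.2.1, inPlane_right _ _⟩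
      have hι := hA.neg_reflect_mem_inv hα hγ
      have e2 := hχ _ ⟨hι.1, hι.2.1, pairing A φ γ, -1, by
        rw [toReal_neg, toReal_reflect]; module⟩
      rw [toReal_neg, toReal_reflect, map_neg, map_sub, map_smul, hχα] at e2
      simp only [smul_eq_mul, mul_zero, sub_zero] at e2
      exact hχγ (by linarith)

end Geometry

/-! ### The stretched Cartan matrix, stretched roots and the roots of the path. -/

section StretchedMatrix

variable {B : Type*} [Fintype B] [DecidableEq B] {M : CoxeterMatrix B}

/-- The vertices outside `{x} ∪ L ∪ R` are not joined to `x`. -/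
def ElasticData.Compatible (E : ElasticData M) (A : Matrix B B ℤ) : Prop :=
  ∀ z, z ≠ E.x → z ∉ E.L → z ∉ E.R → A E.x z = 0 ∧ A z E.x = 0

theorem ElasticData.Compatible.transpose {E : ElasticData M} {A : Matrix B B ℤ}
    (h : E.Compatible A) : E.Compatible A.transpose := fun z h1 h2 h3 => (h z h1 h2 h3).symm

theorem stMatrix_transpose (E : ElasticData M) (A : Matrix B B ℤ) (n : ℕ) :
    (stMatrix E A n).transpose = stMatrix E A.transpose n := by
  ext i j
  rcases i with y | i <;> rcases j with z | j <;>
    simp only [Matrix.transpose_apply, stMatrix]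
  by_cases h : i = j
  · simp [h]
  · rw [if_neg h, if_neg (Ne.symm h)]
    simp only [or_comm]

theorem isGCM_stMatrix (E : ElasticData M) {A : Matrix B B ℤ} (hA : IsGCM A) (n : ℕ) :
    IsGCM (stMatrix E A n) := by
  refine ⟨fun i => ?_, fun i j h => ?_, fun i j h => ?_⟩
  · rcases i with y | i
    · exact hA.diag y
    · simp [stMatrix]
  · rcases i with y | i <;> rcases j with z | j <;> simp only [stMatrix]
    · exact hA.nonpos _ _ fun h' => h (congrArg _ (Subtype.ext h'))
    · split_ifs
      · exact hA.nonpos _ _ y.2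
      · exact le_rfl
    · split_ifs
      · exact hA.nonpos _ _ z.2.symm
      · exact le_rfl
    · rw [if_neg fun h' => h (congrArg _ h')]
      split_ifs <;> simp
  · rcases i with y | i <;> rcases j with z | j <;> simp only [stMatrix] at h ⊢
    · exact hA.zero _ _ h
    · split_ifs at h ⊢
      · exact hA.zero _ _ h
      · rfl
    · split_ifs at h ⊢
      · exact hA.zero _ _ h
      · rfl
    · refine Eq.trans ?_ h
      by_cases h' : i = j
      · simp [h']
      · rw [if_neg h', if_neg (Ne.symm h')]
        simp only [or_comm]

/-- The part of `∑ z, A_{xz} v(z)` over a set `S` of vertices different from `x`. -/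
def partialSum (E : ElasticData M) (A : Matrix B B ℤ) (S : Finset B) (v : B → ℤ) : ℤ :=
  ∑ z : {z : B // z ≠ E.x}, if (z : B) ∈ S then A E.x z * v z else 0

theorem sum_eq_add_partialSum {E : ElasticData M} {A : Matrix B B ℤ} (hA : IsGCM A)
    (hE : E.Compatible A) (v : B → ℤ) :
    A.mulVec v E.x = 2 * v E.x + partialSum E A E.L v + partialSum E A E.R v := by
  rw [Matrix.mulVec, dotProduct, Fintype.sum_eq_add_sum_subtype_ne _ E.x, hA.diag, partialSum,
    partialSum, add_assoc, ← Finset.sum_add_distrib]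
  congr 1
  refine Finset.sum_congr rfl fun z _ => ?_
  have hdis := Finset.disjoint_left.1 E.disjoint
  by_cases h1 : (z : B) ∈ E.L
  · simp [h1, hdis h1]
  · by_cases h2 : (z : B) ∈ E.R
    · simp [h1, h2]
    · simp [h1, h2, (hE z z.2 h1 h2).1]

theorem ite_or_eq (E : ElasticData M) (P Q : Prop) [Decidable P] [Decidable Q] (z : B) (a : ℤ) :
    (if (P ∧ z ∈ E.L) ∨ (Q ∧ z ∈ E.R) then a else 0) =
      (if P then if z ∈ E.L then a else 0 else 0) +
        if Q then if z ∈ E.R then a else 0 else 0 := by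
  have hdis := Finset.disjoint_left.1 E.disjoint
  by_cases h1 : z ∈ E.L
  · simp [h1, hdis h1]
  · simp [h1, ite_and]

/-- The entries of the stretched Cartan matrix along the path. -/
theorem sum_path (n : ℕ) (k : Fin (n + 1)) (f : ℕ → ℤ) :
    ∑ j : Fin (n + 1), (if k = j then 2 else if (k : ℕ) + 1 = (j : ℕ) ∨ (j : ℕ) + 1 = (k : ℕ)
      then -1 else 0) * f j =
      2 * f k - (if (k : ℕ) < n then f (k + 1) else 0) -
        (if 0 < (k : ℕ) then f (k - 1) else 0) := by
  have h1 : ∀ j : Fin (n + 1), (if k = j then 2 else if (k : ℕ) + 1 = (j : ℕ) ∨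
      (j : ℕ) + 1 = (k : ℕ) then -1 else 0) * f j =
      (if (k : ℕ) = (j : ℕ) then 2 * f j else 0) - (if (k : ℕ) + 1 = (j : ℕ) then f j else 0) -
        (if (k : ℕ) - 1 = (j : ℕ) then if 0 < (k : ℕ) then f j else 0 else 0) := fun j => by
    simp only [Fin.ext_iff]
    split_ifs <;> omega
  rw [Finset.sum_congr rfl fun j _ => h1 j]
  rw [Fin.sum_univ_eq_sum_range (fun j => (if (k : ℕ) = j then 2 * f j else 0) -
    (if (k : ℕ) + 1 = j then f j else 0) -
    (if (k : ℕ) - 1 = j then if 0 < (k : ℕ) then f j else 0 else 0)) (n + 1)]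
  rw [Finset.sum_sub_distrib, Finset.sum_sub_distrib, Finset.sum_ite_eq, Finset.sum_ite_eq,
    Finset.sum_ite_eq]
  have hk := k.2
  simp only [Finset.mem_range]
  rw [if_pos hk, if_pos (by omega : (k : ℕ) - 1 < n + 1)]
  simp

theorem mulVec_stFun_inl {E : ElasticData M} {A : Matrix B B ℤ}
    (hE : E.Compatible A) (n : ℕ) (v : B → ℤ) (y : {y : B // y ≠ E.x}) :
    (stMatrix E A n).mulVec (stFun E n v) (Sum.inl y) = A.mulVec v y := by
  rw [Matrix.mulVec, dotProduct, Fintype.sum_sum_type, Matrix.mulVec, dotProduct,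
    Fintype.sum_eq_add_sum_subtype_ne (fun z => A y z * v z) E.x, add_comm]
  simp only [stMatrix, stFun, ite_or_eq]
  rw [← Finset.sum_mul, Finset.sum_add_distrib]
  congr 2
  have h0 : ∀ a : ℤ, ∑ j : Fin (n + 1), (if (j : ℕ) = 0 then a else 0) = a := fun a => by
    rw [Fin.sum_univ_eq_sum_range (fun j => if j = 0 then a else 0) (n + 1)]
    simp
  have hn : ∀ a : ℤ, ∑ j : Fin (n + 1), (if (j : ℕ) = n then a else 0) = a := fun a => by
    rw [Fin.sum_univ_eq_sum_range (fun j => if j = n then a else 0) (n + 1)]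
    simp
  rw [h0, hn]
  have hdis := Finset.disjoint_left.1 E.disjoint
  by_cases h1 : (y : B) ∈ E.L
  · simp [h1, hdis h1]
  · by_cases h2 : (y : B) ∈ E.R
    · simp [h1, h2]
    · simp [h1, h2, (hE y y.2 h1 h2).2]

/-- Interior rows `-1, 2, -1` kill constants, so only the two ends of the path contribute. For `n =
0` the ends coincide and both terms are present. -/
theorem mulVec_stFun_inr (E : ElasticData M) (A : Matrix B B ℤ) (n : ℕ) (v : B → ℤ)
    (i : Fin (n + 1)) :
    (stMatrix E A n).mulVec (stFun E n v) (Sum.inr i) =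
      (if (i : ℕ) = 0 then v E.x + partialSum E A E.L v else 0) +
        if (i : ℕ) = n then v E.x + partialSum E A E.R v else 0 := by
  rw [Matrix.mulVec, dotProduct, Fintype.sum_sum_type]
  simp only [stMatrix, stFun, ite_or_eq]
  rw [sum_path n i fun _ => v E.x]
  have h1 : ∀ (P : Prop) [Decidable P] (S : Finset B),
      ∑ z : {z : B // z ≠ E.x}, (if P then if (z : B) ∈ S then A E.x z else 0 else 0) * v z =
        if P then partialSum E A S v else 0 := fun P _ S => by
    by_cases h : P
    · simp [h, partialSum]
    · simp [h]
  simp only [add_mul]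
  rw [Finset.sum_add_distrib, h1, h1]
  have hi := i.2
  by_cases h0 : (i : ℕ) = 0 <;> by_cases hn : (i : ℕ) = n
  · have e1 : ¬ (i : ℕ) < n := by omega
    have e2 : ¬ 0 < (i : ℕ) := by omega
    rw [if_pos h0, if_pos h0, if_pos hn, if_pos hn, if_neg e1, if_neg e2]; ring
  · have e1 : (i : ℕ) < n := by omega
    have e2 : ¬ 0 < (i : ℕ) := by omega
    rw [if_pos h0, if_pos h0, if_neg hn, if_neg hn, if_pos e1, if_neg e2]; ring
  · have e1 : ¬ (i : ℕ) < n := by omega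
    have e2 : 0 < (i : ℕ) := by omega
    rw [if_neg h0, if_neg h0, if_pos hn, if_pos hn, if_neg e1, if_pos e2]; ring
  · have e1 : (i : ℕ) < n := by omega
    have e2 : 0 < (i : ℕ) := by omega
    rw [if_neg h0, if_neg h0, if_neg hn, if_neg hn, if_pos e1, if_pos e2]; ring

theorem sum_fin_ite_eq_zero (n : ℕ) (f : ℕ → ℤ) :
    ∑ i : Fin (n + 1), (if (i : ℕ) = 0 then f i else 0) = f 0 := by
  rw [Fin.sum_univ_eq_sum_range (fun i => if i = 0 then f i else 0) (n + 1)]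
  simp

theorem sum_fin_ite_eq_last (n : ℕ) (f : ℕ → ℤ) :
    ∑ i : Fin (n + 1), (if (i : ℕ) = n then f i else 0) = f n := by
  rw [Fin.sum_univ_eq_sum_range (fun i => if i = n then f i else 0) (n + 1)]
  simp

/-- The two ends of the path together give `2 v(x)` and both neighbour sums, which is the row of `x`
in `A`. -/
theorem pairing_stFun_stFun {E : ElasticData M} {A : Matrix B B ℤ} (hA : IsGCM A)
    (hE : E.Compatible A) (n : ℕ) (φ v : B → ℤ) :
    pairing (stMatrix E A n) (stFun E n φ) (stFun E n v) = pairing A φ v := by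
  rw [pairing, dotProduct, Fintype.sum_sum_type, pairing, dotProduct,
    Fintype.sum_eq_add_sum_subtype_ne (fun z => φ z * A.mulVec v z) E.x, add_comm,
    sum_eq_add_partialSum hA hE]
  congr 1
  · simp only [mulVec_stFun_inr, stFun]
    rw [← Finset.mul_sum, Finset.sum_add_distrib,
      sum_fin_ite_eq_zero n fun _ => v E.x + partialSum E A E.L v,
      sum_fin_ite_eq_last n fun _ => v E.x + partialSum E A E.R v]
    ring
  · refine Finset.sum_congr rfl fun y _ => ?_
    rw [mulVec_stFun_inl hE]
    rfl

/-- The sum `α_{x_0} + ⋯ + α_{x_j}` of simple roots along the path. -/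
def beta (E : ElasticData M) (n j : ℕ) : StVertex E n → ℤ
  | Sum.inl _ => 0
  | Sum.inr i => if (i : ℕ) ≤ j then 1 else 0

/-- The pairing of `st_n(φ)` with the vectors `β_{x_j}`, `j < n`. -/
def leftPairing (E : ElasticData M) (A : Matrix B B ℤ) (φ : B → ℤ) : ℤ :=
  φ E.x + partialSum E A.transpose E.L φ

/-- For `j < n` the support of `β_{x_j}` omits `x_n`, so only the end `x_0` contributes and the
value depends on neither `n` nor `j`. All the uniformity in `n` comes from this. -/
theorem pairing_stFun_beta (E : ElasticData M) (A : Matrix B B ℤ) {n j : ℕ} (hj : j < n)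
    (φ : B → ℤ) : pairing (stMatrix E A n) (stFun E n φ) (beta E n j) = leftPairing E A φ := by
  rw [← pairing_transpose, stMatrix_transpose, pairing, dotProduct, Fintype.sum_sum_type]
  simp only [mulVec_stFun_inr, beta, zero_mul, Finset.sum_const_zero, zero_add]
  rw [Finset.sum_congr rfl fun i _ => mul_add _ _ _, Finset.sum_add_distrib]
  simp only [mul_ite _ ((if _ then _ else _) : ℤ), mul_zero]
  rw [sum_fin_ite_eq_zero n fun i => (if i ≤ j then 1 else 0) *
      (φ E.x + partialSum E A.transpose E.L φ),
    sum_fin_ite_eq_last n fun i => (if i ≤ j then 1 else 0) *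
      (φ E.x + partialSum E A.transpose E.R φ)]
  simp [leftPairing, hj]

theorem leftPairing_simpleRoot_x (E : ElasticData M) (A : Matrix B B ℤ) :
    leftPairing E A (simpleRoot E.x) = 1 := by
  rw [leftPairing, partialSum, Finset.sum_eq_zero]
  · simp [simpleRoot]
  · intro z _
    simp [simpleRoot, z.2]

theorem pairing_inr_beta (E : ElasticData M) (A : Matrix B B ℤ) (n : ℕ) (k : Fin (n + 1))
    (i : ℕ) : pairing (stMatrix E A n) (simpleRoot (Sum.inr k)) (beta E n i) =
      2 * (if (k : ℕ) ≤ i then 1 else 0) -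
        (if (k : ℕ) < n then if (k : ℕ) + 1 ≤ i then 1 else 0 else 0) -
        (if 0 < (k : ℕ) then if (k : ℕ) - 1 ≤ i then 1 else 0 else 0) := by
  rw [pairing_simpleRoot_left, Fintype.sum_sum_type]
  simp only [stMatrix, beta, mul_zero, Finset.sum_const_zero, zero_add]
  exact sum_path n k fun j => if j ≤ i then 1 else 0

theorem pairing_beta_inr (E : ElasticData M) (A : Matrix B B ℤ) (n : ℕ) (k : Fin (n + 1))
    (i : ℕ) : pairing (stMatrix E A n) (beta E n i) (simpleRoot (Sum.inr k)) =
      2 * (if (k : ℕ) ≤ i then 1 else 0) -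
        (if (k : ℕ) < n then if (k : ℕ) + 1 ≤ i then 1 else 0 else 0) -
        (if 0 < (k : ℕ) then if (k : ℕ) - 1 ≤ i then 1 else 0 else 0) := by
  rw [← pairing_transpose, stMatrix_transpose, pairing_inr_beta]

theorem beta_succ (E : ElasticData M) {n j : ℕ} (hj : j + 1 < n + 1) :
    beta E n (j + 1) = beta E n j + simpleRoot (Sum.inr ⟨j + 1, hj⟩) := by
  ext z
  rcases z with z | z
  · simp [beta, simpleRoot]
  · simp only [beta, simpleRoot, Pi.add_apply, Pi.single_apply, Sum.inr.injEq, Fin.ext_iff]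
    split_ifs <;> omega

theorem beta_zero (E : ElasticData M) (n : ℕ) : beta E n 0 = simpleRoot (Sum.inr 0) := by
  ext z
  rcases z with z | z
  · simp [beta, simpleRoot]
  · simp only [beta, simpleRoot, Pi.single_apply, Sum.inr.injEq, Fin.ext_iff]
    simp

theorem simpleReflection_beta (E : ElasticData M) (A : Matrix B B ℤ) {n j : ℕ}
    (hj : j + 1 < n + 1) :
    simpleReflection (stMatrix E A n) (Sum.inr ⟨j + 1, hj⟩) (beta E n j) = beta E n (j + 1) := by
  rw [simpleReflection_eq_reflect, reflect, pairing_inr_beta, beta_succ E hj]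
  simp

theorem simpleReflection_beta_of_lt (E : ElasticData M) (A : Matrix B B ℤ) {n i j : ℕ}
    (hj : j + 1 < n + 1) (hi : i < j) :
    simpleReflection (stMatrix E A n) (Sum.inr ⟨j + 1, hj⟩) (beta E n i) = beta E n i := by
  rw [simpleReflection_eq_reflect, reflect, pairing_inr_beta]
  have h1 : ¬ j + 1 ≤ i := by omega
  have h2 : ¬ j + 1 + 1 ≤ i := by omega
  have h3 : ¬ j ≤ i := by omega
  simp [h1, h2, h3]

theorem isBiroot_beta (E : ElasticData M) (A : Matrix B B ℤ) {n j : ℕ} (hj : j < n + 1) :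
    IsBiroot (stMatrix E A n) (beta E n j) (beta E n j) := by
  induction j with
  | zero => rw [beta_zero]; exact isBiroot_simpleRoot _ _
  | succ j ih =>
    have := (ih (by omega)).simpleReflection (Sum.inr ⟨j + 1, hj⟩)
    rwa [stMatrix_transpose, simpleReflection_beta, simpleReflection_beta] at this

/-- The path is of type A, with `β_{x_{j+1}} = s_{x_{j+1}} β_{x_j}`. That reflection fixes `β_{x_i}`
for `i < j`, and the step contributes the new pair `β_{x_j}`, `α_{x_{j+1}}`. -/
theorem inv_beta_subset (E : ElasticData M) {A : Matrix B B ℤ} (hA : IsGCM A) {n j : ℕ}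
    (hj : j < n + 1) {γ : StVertex E n → ℤ}
    (hγ : γ ∈ inv (stMatrix E A n) (beta E n j) (beta E n j)) :
    ∃ i < j, γ = beta E n i ∨ γ = beta E n j - beta E n i := by
  induction j generalizing γ with
  | zero => rw [beta_zero, (isGCM_stMatrix E hA n).inv_simpleRoot] at hγ; exact hγ.elim
  | succ j ih =>
    have hn := isGCM_stMatrix E hA n
    have hs : simpleRoot (Sum.inr ⟨j + 1, hj⟩) = beta E n (j + 1) - beta E n j := by
      rw [beta_succ E hj]; abel
    rcases hn.inv_subset (isBiroot_beta E A hj) (Sum.inr ⟨j + 1, hj⟩) hγ with (h | h) | h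
    · exact ⟨j, by omega, Or.inr (h.trans hs)⟩
    · refine ⟨j, by omega, Or.inl ?_⟩
      rw [Set.mem_singleton_iff] at h
      rw [h, reflect, pairing_beta_inr, hs]
      simp
    · obtain ⟨γ', hγ', rfl⟩ := h
      rw [← simpleReflection_beta E A hj, hn.simpleReflection_invol, stMatrix_transpose,
        simpleReflection_beta E A hj, ← simpleReflection_beta E A.transpose hj,
        (isGCM_stMatrix E hA.transpose n).simpleReflection_invol] at hγ'
      obtain ⟨i, hi, rfl | rfl⟩ := ih (by omega) hγ'
      · exact ⟨i, by omega, Or.inl (simpleReflection_beta_of_lt E A hj hi)⟩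
      · refine ⟨i, by omega, Or.inr ?_⟩
        rw [simpleReflection_sub, simpleReflection_beta, simpleReflection_beta_of_lt E A hj hi]

theorem stFun_sub (E : ElasticData M) (n : ℕ) (u v : B → ℤ) :
    stFun E n (u - v) = stFun E n u - stFun E n v := by
  ext z; rcases z with z | z <;> rfl

theorem stFun_neg (E : ElasticData M) (n : ℕ) (v : B → ℤ) :
    stFun E n (-v) = -stFun E n v := by
  ext z; rcases z with z | z <;> rfl

theorem stFun_smul (E : ElasticData M) (n : ℕ) (c : ℤ) (v : B → ℤ) :
    stFun E n (c • v) = c • stFun E n v := by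
  ext z; rcases z with z | z <;> rfl

theorem stFun_injective (E : ElasticData M) (n : ℕ) : Function.Injective (stFun E n) := by
  intro u v h
  ext y
  by_cases hy : y = E.x
  · subst hy; exact congrFun h (Sum.inr 0)
  · exact congrFun h (Sum.inl ⟨y, hy⟩)

theorem stFun_nonneg (E : ElasticData M) (n : ℕ) {v : B → ℤ} (h : 0 ≤ v) : 0 ≤ stFun E n v := by
  intro z; rcases z with z | z <;> exact h _

theorem stFun_simpleRoot_x (E : ElasticData M) (n : ℕ) :
    stFun E n (simpleRoot E.x) = beta E n n := by
  ext z
  rcases z with z | z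
  · simp [stFun, beta, simpleRoot, z.2]
  · have := z.2
    simp [stFun, beta, simpleRoot, Nat.lt_succ_iff.1 this]

theorem stFun_simpleRoot_ne (E : ElasticData M) (n : ℕ) {y : B} (hy : y ≠ E.x) :
    stFun E n (simpleRoot y) = simpleRoot (Sum.inl ⟨y, hy⟩) := by
  ext z
  rcases z with z | z
  · simp [stFun, simpleRoot, Pi.single_apply, Subtype.ext_iff]
  · simp [stFun, simpleRoot, hy.symm]

theorem stFun_reflect {E : ElasticData M} {A : Matrix B B ℤ} (hA : IsGCM A)
    (hE : E.Compatible A) (n : ℕ) (α φ v : B → ℤ) :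
    stFun E n (reflect A α φ v) =
      reflect (stMatrix E A n) (stFun E n α) (stFun E n φ) (stFun E n v) := by
  rw [reflect, reflect, stFun_sub, stFun_smul, pairing_stFun_stFun hA hE]

theorem isBiroot_stFun_simpleRoot (E : ElasticData M) (A : Matrix B B ℤ) (n : ℕ) (y : B) :
    IsBiroot (stMatrix E A n) (stFun E n (simpleRoot y)) (stFun E n (simpleRoot y)) := by
  by_cases hy : y = E.x
  · rw [hy, stFun_simpleRoot_x]; exact isBiroot_beta E A (by omega)
  · rw [stFun_simpleRoot_ne E n hy]; exact isBiroot_simpleRoot _ _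

theorem isBiroot_stFun {E : ElasticData M} {A : Matrix B B ℤ} (hA : IsGCM A)
    (hE : E.Compatible A) (n : ℕ) {α φ : B → ℤ} (h : IsBiroot A α φ) :
    IsBiroot (stMatrix E A n) (stFun E n α) (stFun E n φ) := by
  refine h.induction (P := fun α φ => IsBiroot (stMatrix E A n) (stFun E n α) (stFun E n φ))
    (isBiroot_stFun_simpleRoot E A n) fun α φ y _ ih => ?_
  have := (isGCM_stMatrix E hA n).isBiroot_reflect (isBiroot_stFun_simpleRoot E A n y) ih
  rwa [stMatrix_transpose, ← stFun_reflect hA hE, ← stFun_reflect hA.transpose hE.transpose,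
    ← simpleReflection_eq_reflect, ← simpleReflection_eq_reflect] at this

end StretchedMatrix

/-! ### Uniform shape of the inversions of stretched roots. -/

section Uniformity

variable {B : Type*} [Fintype B] [DecidableEq B] {M : CoxeterMatrix B}

/-- Because `j < n`, the value at `x_n` is `f(x)`; the jump can then be read off from the rest of
the path. -/
theorem stFun_add_smul_beta_inj {E : ElasticData M} {n j j' : ℕ} (hj : j < n) (hj' : j' < n)
    {f f' : B → ℤ} {ε ε' : ℤ}
    (h : stFun E n f + ε • beta E n j = stFun E n f' + ε' • beta E n j') :
    f = f' ∧ ε = ε' ∧ (ε ≠ 0 → j = j') := by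
  have hf : f = f' := by
    ext y
    by_cases hy : y = E.x
    · have := congrFun h (Sum.inr (Fin.last n))
      simpa [stFun, beta, not_le.2 hj, not_le.2 hj', hy] using this
    · have := congrFun h (Sum.inl ⟨y, hy⟩)
      simpa [stFun, beta] using this
  subst hf
  have h1 : ε • beta E n j = ε' • beta E n j' := add_left_cancel h
  have hε : ε = ε' := by simpa [beta] using congrFun h1 (Sum.inr 0)
  subst hε
  refine ⟨rfl, rfl, fun h0 => ?_⟩
  have h2 : beta E n j = beta E n j' := smul_right_injective _ h0 h1
  rcases lt_trichotomy j j' with hlt | heq | hlt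
  · have := congrFun h2 (Sum.inr ⟨j + 1, by omega⟩)
    simp only [beta] at this
    rw [if_neg (by omega), if_pos (by omega)] at this
    omega
  · exact heq
  · have := congrFun h2 (Sum.inr ⟨j' + 1, by omega⟩)
    simp only [beta] at this
    rw [if_pos (by omega), if_neg (by omega)] at this
    omega

theorem stFun_zero (E : ElasticData M) (n : ℕ) : stFun E n 0 = 0 := by
  ext z; rcases z with z | z <;> rfl

/-- The reflection subtracts a multiple of a stretched vector, so the jump `ε β_{x_j}` survives
unchanged while `f` moves by a rule independent of `n` and `j`. -/
theorem reflect_stFun_add_smul_beta {E : ElasticData M} {A : Matrix B B ℤ} (hA : IsGCM A)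
    (hE : E.Compatible A) {n j : ℕ} (hj : j < n) (α φ f : B → ℤ) (ε : ℤ) :
    reflect (stMatrix E A n) (stFun E n α) (stFun E n φ) (stFun E n f + ε • beta E n j) =
      stFun E n (reflect A α φ f - (ε * leftPairing E A φ) • α) + ε • beta E n j := by
  rw [stFun_sub, stFun_reflect hA hE, reflect, reflect, pairing_add_right, pairing_smul_right,
    pairing_stFun_beta E A hj, stFun_smul]
  module

/-- The vectors that are constant along the path up to at most one jump by `±1`. -/
def IsPathVector (E : ElasticData M) (n : ℕ) (γ : StVertex E n → ℤ) : Prop :=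
  ∃ f : B → ℤ, γ = stFun E n f ∨
    ∃ j < n, γ = stFun E n f + beta E n j ∨ γ = stFun E n f - beta E n j

theorem isPathVector_iff {E : ElasticData M} {n : ℕ} {γ : StVertex E n → ℤ} :
    IsPathVector E n γ ↔ (∃ f, γ = stFun E n f) ∨
      ∃ f, ∃ j < n, ∃ ε : ℤ, (ε = 1 ∨ ε = -1) ∧ γ = stFun E n f + ε • beta E n j := by
  constructor
  · rintro ⟨f, h | ⟨j, hj, h | h⟩⟩
    · exact Or.inl ⟨f, h⟩
    · exact Or.inr ⟨f, j, hj, 1, Or.inl rfl, by rw [h, one_smul]⟩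
    · exact Or.inr ⟨f, j, hj, -1, Or.inr rfl, by rw [h]; module⟩
  · rintro (⟨f, h⟩ | ⟨f, j, hj, ε, rfl | rfl, h⟩)
    · exact ⟨f, Or.inl h⟩
    · exact ⟨f, Or.inr ⟨j, hj, Or.inl (by rw [h, one_smul])⟩⟩
    · exact ⟨f, Or.inr ⟨j, hj, Or.inr (by rw [h]; module)⟩⟩

theorem IsPathVector.neg {E : ElasticData M} {n : ℕ} {γ : StVertex E n → ℤ}
    (h : IsPathVector E n γ) : IsPathVector E n (-γ) := by
  rw [isPathVector_iff] at h ⊢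
  rcases h with ⟨f, rfl⟩ | ⟨f, j, hj, ε, hε, rfl⟩
  · exact Or.inl ⟨-f, (stFun_neg E n f).symm⟩
  · exact Or.inr ⟨-f, j, hj, -ε, by omega, by rw [stFun_neg]; module⟩

theorem IsPathVector.reflect {E : ElasticData M} {A : Matrix B B ℤ} (hA : IsGCM A)
    (hE : E.Compatible A) {n : ℕ} {γ : StVertex E n → ℤ} (h : IsPathVector E n γ)
    (α φ : B → ℤ) :
    IsPathVector E n (reflect (stMatrix E A n) (stFun E n α) (stFun E n φ) γ) := by
  rw [isPathVector_iff] at h ⊢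
  rcases h with ⟨f, rfl⟩ | ⟨f, j, hj, ε, hε, rfl⟩
  · exact Or.inl ⟨_, (stFun_reflect hA hE n α φ f).symm⟩
  · exact Or.inr ⟨_, j, hj, ε, hε, reflect_stFun_add_smul_beta hA hE hj α φ f ε⟩

theorem beta_nonneg (E : ElasticData M) (n j : ℕ) : 0 ≤ beta E n j := by
  intro z
  rcases z with z | z
  · exact le_rfl
  · simp only [beta, Pi.zero_apply]; split_ifs <;> omega

theorem stFun_simpleRoot_x_sub_beta_nonneg (E : ElasticData M) (n j : ℕ) :
    0 ≤ stFun E n (simpleRoot E.x) - beta E n j := by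
  intro z
  rcases z with z | z
  · simp [stFun, beta, simpleRoot, z.2]
  · simp only [stFun, beta, simpleRoot, Pi.zero_apply, Pi.sub_apply, Pi.single_eq_same]
    split_ifs <;> omega

theorem isRoot_stFun_simpleRoot_x_sub_beta {E : ElasticData M} {A : Matrix B B ℤ}
    (hA : IsGCM A) {n j : ℕ} (hj : j < n) :
    IsRoot (stMatrix E A n) (stFun E n (simpleRoot E.x) - beta E n j) := by
  have hn := isGCM_stMatrix E hA n
  have h := hn.isRoot_neg_iff.2 (hn.isRoot_reflect (isBiroot_stFun_simpleRoot E A n E.x)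
    (isBiroot_beta E A (by omega : j < n + 1)).isRoot)
  rw [reflect, pairing_stFun_beta E A hj, leftPairing_simpleRoot_x, one_smul, neg_sub] at h
  exact h

/-- The possible positive roots made negative by the reflection in `st_n(α_y)`. -/
def IsStretchInversion (E : ElasticData M) (n : ℕ) (y : B) (ν : StVertex E n → ℤ) : Prop :=
  ν = stFun E n (simpleRoot y) ∨ (y = E.x ∧ ∃ j < n,
    ν = beta E n j ∨ ν = stFun E n (simpleRoot E.x) - beta E n j)

theorem isStretchInversion_of_reflect_nonpos {E : ElasticData M} {A : Matrix B B ℤ}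
    (hA : IsGCM A) {n : ℕ} {y : B} {ν : StVertex E n → ℤ} (hν : IsRoot (stMatrix E A n) ν)
    (h0 : 0 ≤ ν) (h : reflect (stMatrix E A n) (stFun E n (simpleRoot y))
      (stFun E n (simpleRoot y)) ν ≤ 0) : IsStretchInversion E n y ν := by
  have hn := isGCM_stMatrix E hA n
  by_cases hy : y = E.x
  · subst hy
    by_cases h1 : ν = stFun E n (simpleRoot E.x)
    · exact Or.inl h1
    refine Or.inr ⟨rfl, ?_⟩
    rw [stFun_simpleRoot_x] at h h1 ⊢
    refine inv_beta_subset E hA (by omega) ⟨hν, h0, h1, ?_, h⟩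
    rintro rfl
    have := (isBiroot_beta E A (by omega : n < n + 1)).isRoot
    exact hn.not_nonpos this (beta_nonneg E n n) (neg_nonneg.1 h0)
  · left
    rw [stFun_simpleRoot_ne E n hy] at h ⊢
    exact hn.eq_simpleRoot_of_reflect_nonpos hν h0 h

theorem IsStretchInversion.isPathVector {E : ElasticData M} {n : ℕ} {y : B}
    {ν : StVertex E n → ℤ} (h : IsStretchInversion E n y ν) : IsPathVector E n ν := by
  rcases h with h | ⟨-, j, hj, h | h⟩
  · exact ⟨_, Or.inl h⟩
  · exact ⟨0, Or.inr ⟨j, hj, Or.inl (by rw [stFun_zero, zero_add, h])⟩⟩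
  · exact ⟨_, Or.inr ⟨j, hj, Or.inr h⟩⟩

/-- The root `α` is positive at some vertex other than `y`, and all the candidates `ν` vanish over
that vertex, so the sign of the pairing decides. -/
theorem IsStretchInversion.mem_inv_iff {E : ElasticData M} {A : Matrix B B ℤ} (hA : IsGCM A)
    (hE : E.Compatible A) {α φ : B → ℤ} (hα : IsBiroot A α φ) (h0 : 0 ≤ α) {y : B}
    (hy : α ≠ simpleRoot y) {n : ℕ} {ν : StVertex E n → ℤ} (h : IsStretchInversion E n y ν)
    (hν : IsRoot (stMatrix E A n) ν) (hν0 : 0 ≤ ν) :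
    ν ∈ inv (stMatrix E A n) (stFun E n α) (stFun E n φ) ↔
      0 < pairing (stMatrix E A n) (stFun E n φ) ν := by
  have hn := isGCM_stMatrix E hA n
  have hst := isBiroot_stFun hA hE n hα
  obtain ⟨z, hz, hpos⟩ := hA.exists_pos_of_ne hα.isRoot h0 hy
  by_cases hzx : z = E.x
  · refine hn.mem_inv_iff_pairing_pos hst hν hν0 (z := Sum.inr 0) (by simpa [stFun, ← hzx]) ?_
    rcases h with rfl | ⟨h, -⟩
    · simp [stFun, simpleRoot, ← hzx, hz]
    · exact absurd (hzx.trans h.symm) hz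
  · refine hn.mem_inv_iff_pairing_pos hst hν hν0 (z := Sum.inl ⟨z, hzx⟩) (by simpa [stFun]) ?_
    rcases h with rfl | ⟨-, j, -, rfl | rfl⟩
    · simp [stFun, simpleRoot, hz]
    · simp [beta]
    · simp [beta, stFun, simpleRoot, hzx]

theorem mem_inv_stFun {E : ElasticData M} {A : Matrix B B ℤ} (hA : IsGCM A)
    (hE : E.Compatible A) {α φ : B → ℤ} (hα : IsBiroot A α φ) (y : B) (n : ℕ)
    (γ : StVertex E n → ℤ) :
    (γ ∈ inv (stMatrix E A n) (stFun E n α) (stFun E n φ) ↔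
      reflect (stMatrix E A n) (stFun E n (simpleRoot y)) (stFun E n (simpleRoot y)) γ ∈
        inv (stMatrix E A n) (stFun E n (simpleReflection A y α))
          (stFun E n (simpleReflection A.transpose y φ))) ∨
    ∃ ν, IsRoot (stMatrix E A n) ν ∧ 0 ≤ ν ∧ IsStretchInversion E n y ν ∧
      (γ = ν ∨ γ = -ν ∨ γ = reflect (stMatrix E A n) (stFun E n α) (stFun E n φ) ν ∨
        γ = -reflect (stMatrix E A n) (stFun E n α) (stFun E n φ) ν) := by
  have h := (isGCM_stMatrix E hA n).mem_inv_reflect (isBiroot_stFun_simpleRoot E A n y)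
    (isBiroot_stFun hA hE n hα) γ
  rw [stMatrix_transpose, ← stFun_reflect hA hE, ← stFun_reflect hA.transpose hE.transpose,
    ← simpleReflection_eq_reflect, ← simpleReflection_eq_reflect] at h
  refine h.imp_right ?_
  rintro ⟨ν, h1, h2, h3, h4⟩
  exact ⟨ν, h1, h2, isStretchInversion_of_reflect_nonpos hA h1 h2 h3, h4⟩

/-- The inversions of all the stretches of `α` have the same shape. -/
structure IsUniform (E : ElasticData M) (A : Matrix B B ℤ) (α φ : B → ℤ) : Prop where
  isPathVector : ∀ n, ∀ γ ∈ inv (stMatrix E A n) (stFun E n α) (stFun E n φ), IsPathVector E n γ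
  stFun_mem : ∀ n f, stFun E n f ∈ inv (stMatrix E A n) (stFun E n α) (stFun E n φ) ↔
    f ∈ inv A α φ
  exists_set : ∃ K : Set (B → ℤ), ∀ n, ∀ j < n, ∀ g,
    stFun E n g - beta E n j ∈ inv (stMatrix E A n) (stFun E n α) (stFun E n φ) ↔ g ∈ K

theorem isUniform_simpleRoot {E : ElasticData M} {A : Matrix B B ℤ} (hA : IsGCM A) (y : B) :
    IsUniform E A (simpleRoot y) (simpleRoot y) := by
  by_cases hy : y = E.x
  · subst hy
    have hcases : ∀ n, ∀ γ ∈ inv (stMatrix E A n) (stFun E n (simpleRoot E.x))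
        (stFun E n (simpleRoot E.x)), ∃ i < n, γ = stFun E n 0 + (1 : ℤ) • beta E n i ∨
          γ = stFun E n (simpleRoot E.x) + (-1 : ℤ) • beta E n i := fun n γ hγ => by
      rw [stFun_simpleRoot_x] at hγ ⊢
      obtain ⟨i, hi, h | h⟩ := inv_beta_subset E hA (by omega) hγ
      · exact ⟨i, hi, Or.inl (by rw [h, stFun_zero]; module)⟩
      · exact ⟨i, hi, Or.inr (by rw [h]; module)⟩
    refine ⟨fun n γ hγ => ?_, fun n f => ?_, {simpleRoot E.x}, fun n j hj g => ?_⟩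
    · rw [isPathVector_iff]
      obtain ⟨i, hi, h | h⟩ := hcases n γ hγ
      · exact Or.inr ⟨_, i, hi, _, Or.inl rfl, h⟩
      · exact Or.inr ⟨_, i, hi, _, Or.inr rfl, h⟩
    · rw [hA.inv_simpleRoot]
      refine iff_of_false (fun hγ => ?_) id
      obtain ⟨i, hi, h | h⟩ := hcases n _ hγ <;>
      · rw [← add_zero (stFun E n f), ← zero_smul ℤ (beta E n i)] at h
        have := (stFun_add_smul_beta_inj hi hi h).2.1
        omega
    · rw [Set.mem_singleton_iff]
      constructor
      · intro hγ
        have e : stFun E n g - beta E n j = stFun E n g + (-1 : ℤ) • beta E n j := by module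
        obtain ⟨i, hi, h | h⟩ := hcases n _ hγ <;> rw [e] at h
        · have := (stFun_add_smul_beta_inj hj hi h).2.1
          omega
        · exact (stFun_add_smul_beta_inj hj hi h).1
      · rintro rfl
        rw [(isGCM_stMatrix E hA n).mem_inv_iff_pairing_pos (isBiroot_stFun_simpleRoot E A n E.x)
          (isRoot_stFun_simpleRoot_x_sub_beta hA hj) (stFun_simpleRoot_x_sub_beta_nonneg E n j)
          (z := Sum.inr 0) (by simp [stFun, simpleRoot]) (by simp [stFun, simpleRoot, beta]),
          pairing_sub_right, pairing_stFun_beta E A hj, leftPairing_simpleRoot_x,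
          (isGCM_stMatrix E hA n).pairing_self (isBiroot_stFun_simpleRoot E A n E.x)]
        norm_num
  · have hempty : ∀ n, inv (stMatrix E A n) (stFun E n (simpleRoot y))
        (stFun E n (simpleRoot y)) = ∅ := fun n => by
      rw [stFun_simpleRoot_ne E n hy, (isGCM_stMatrix E hA n).inv_simpleRoot]
    exact ⟨fun n γ hγ => by rw [hempty] at hγ; exact hγ.elim,
      fun n f => by rw [hempty, hA.inv_simpleRoot]; exact Iff.rfl,
      ∅, fun n j hj g => by rw [hempty]; exact Iff.rfl⟩

/-- Jump-free vectors meet only the jump-free exceptional root `st_n(α_y)`, its negative and their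
images under the reflection in `st_n(α)`. For these, membership is decided by a pairing that
stretching preserves. -/
theorem stFun_mem_inv_iff_of_step {E : ElasticData M} {A : Matrix B B ℤ} (hA : IsGCM A)
    (hE : E.Compatible A) {α φ : B → ℤ} (hα : IsBiroot A α φ) (h0 : 0 ≤ α) {y : B}
    (hy : α ≠ simpleRoot y) (n : ℕ)
    (ih : ∀ f, stFun E n f ∈ inv (stMatrix E A n) (stFun E n (simpleReflection A y α))
      (stFun E n (simpleReflection A.transpose y φ)) ↔
        f ∈ inv A (simpleReflection A y α) (simpleReflection A.transpose y φ)) (f : B → ℤ) :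
    stFun E n f ∈ inv (stMatrix E A n) (stFun E n α) (stFun E n φ) ↔ f ∈ inv A α φ := by
  have hn := isGCM_stMatrix E hA n
  have hst := isBiroot_stFun hA hE n hα
  have hyst := isBiroot_stFun_simpleRoot E A n y
  have hyr := (isBiroot_simpleRoot A y).isRoot
  have hy0 := simpleRoot_nonneg y
  have hsimple : stFun E n (simpleRoot y) ∈ inv (stMatrix E A n) (stFun E n α) (stFun E n φ) ↔
      simpleRoot y ∈ inv A α φ := by
    obtain ⟨z, hz, hpos⟩ := hA.exists_pos_of_ne hα.isRoot h0 hy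
    rw [hA.mem_inv_iff_pairing_pos hα hyr hy0 hpos (by simp [simpleRoot, hz]),
      IsStretchInversion.mem_inv_iff hA hE hα h0 hy (Or.inl rfl) hyst.isRoot
        (stFun_nonneg E n hy0), pairing_stFun_stFun hA hE]
  rcases hA.mem_inv_simpleReflection hα y f with h | rfl | rfl | rfl | rfl
  · rcases mem_inv_stFun hA hE hα y n (stFun E n f) with h' | ⟨ν, hν, hν0, hνs, h'⟩
    · rw [h', h, ← stFun_reflect hA hE, ← simpleReflection_eq_reflect, ih]
    · rcases hνs with rfl | ⟨rfl, j, hj, hνj⟩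
      · rw [← stFun_reflect hA hE, ← stFun_neg, ← stFun_neg] at h'
        rcases h' with h' | h' | h' | h' <;> obtain rfl := stFun_injective E n h'
        · exact hsimple
        · rw [stFun_neg]
          exact iff_of_false (hn.neg_notMem_inv hyst.isRoot (stFun_nonneg E n hy0))
            (hA.neg_notMem_inv hyr hy0)
        · rw [stFun_reflect hA hE]
          exact iff_of_false (hn.reflect_notMem_inv hst hyst.isRoot (stFun_nonneg E n hy0))
            (hA.reflect_notMem_inv hα hyr hy0)
        · rw [stFun_neg, stFun_reflect hA hE, hn.neg_reflect_mem_inv_iff hst,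
            hA.neg_reflect_mem_inv_iff hα]
          exact hsimple
      · exfalso
        obtain ⟨u, ε, hε, rfl⟩ : ∃ u, ∃ ε : ℤ, ε ≠ 0 ∧ ν = stFun E n u + ε • beta E n j := by
          rcases hνj with rfl | rfl
          · exact ⟨0, 1, one_ne_zero, by rw [stFun_zero]; module⟩
          · exact ⟨simpleRoot E.x, -1, by norm_num, by module⟩
        obtain ⟨u', ε', hε', h''⟩ : ∃ u', ∃ ε' : ℤ, ε' ≠ 0 ∧
            stFun E n f = stFun E n u' + ε' • beta E n j := by
          rw [reflect_stFun_add_smul_beta hA hE hj] at h'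
          rcases h' with h' | h' | h' | h'
          · exact ⟨_, _, hε, h'⟩
          · exact ⟨-u, -ε, neg_ne_zero.2 hε, by rw [h', stFun_neg]; module⟩
          · exact ⟨_, _, hε, h'⟩
          · exact ⟨-(reflect A α φ u - (ε * leftPairing E A φ) • α), -ε, neg_ne_zero.2 hε, by
              rw [h', stFun_neg]; module⟩
        rw [← add_zero (stFun E n f), ← zero_smul ℤ (beta E n j)] at h''
        exact hε' (stFun_add_smul_beta_inj hj hj h'').2.1.symm
  · exact hsimple
  · rw [stFun_neg]
    exact iff_of_false (hn.neg_notMem_inv hyst.isRoot (stFun_nonneg E n hy0))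
      (hA.neg_notMem_inv hyr hy0)
  · rw [stFun_reflect hA hE]
    exact iff_of_false (hn.reflect_notMem_inv hst hyst.isRoot (stFun_nonneg E n hy0))
      (hA.reflect_notMem_inv hα hyr hy0)
  · rw [stFun_neg, stFun_reflect hA hE, hn.neg_reflect_mem_inv_iff hst,
      hA.neg_reflect_mem_inv_iff hα]
    exact hsimple

theorem exists_set_of_step {E : ElasticData M} {A : Matrix B B ℤ} (hA : IsGCM A)
    (hE : E.Compatible A) {α φ : B → ℤ} (hα : IsBiroot A α φ) (h0 : 0 ≤ α) {y : B}
    (hy : α ≠ simpleRoot y)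
    (ih : ∃ K : Set (B → ℤ), ∀ n, ∀ j < n, ∀ g, stFun E n g - beta E n j ∈
      inv (stMatrix E A n) (stFun E n (simpleReflection A y α))
        (stFun E n (simpleReflection A.transpose y φ)) ↔ g ∈ K) :
    ∃ K : Set (B → ℤ), ∀ n, ∀ j < n, ∀ g,
      stFun E n g - beta E n j ∈ inv (stMatrix E A n) (stFun E n α) (stFun E n φ) ↔ g ∈ K := by
  obtain ⟨K, hK⟩ := ih
  set c := leftPairing E A φ with hc
  set c' := pairing A φ (simpleRoot E.x) - c with hc'
  -- The exceptional vectors with jump `-1` are `β_{x_n} - β_{x_j}`, `-β_{x_j}`, the image of the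
  -- former under the reflection in `st_n(α)`, and the negated image of `β_{x_j}`. The numbers `c`
  -- and `c'` are the pairings of `st_n(φ)` with `β_{x_j}` and `β_{x_n} - β_{x_j}`. The second and
  -- third are never inversions; the first and fourth are exactly when `c' > 0`, respectively `c >
  -- 0`. Every other `g` is pulled back along the reflection in `st_n(α_y)`.
  let exc : (B → ℤ) → Prop := fun g => y = E.x ∧ (g = simpleRoot E.x ∨ g = 0 ∨
    g = simpleRoot E.x - c' • α ∨ g = c • α)
  refine ⟨{g | (y = E.x ∧ g = simpleRoot E.x ∧ 0 < c') ∨ (y = E.x ∧ g = c • α ∧ 0 < c) ∨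
    (¬ exc g ∧ simpleReflection A y g + leftPairing E A (simpleRoot y) • simpleRoot y ∈ K)},
    fun n j hj g => ?_⟩
  have hn := isGCM_stMatrix E hA n
  have hst := isBiroot_stFun hA hE n hα
  have hβ := (isBiroot_beta E A (by omega : j < n + 1)).isRoot
  have hτ := isRoot_stFun_simpleRoot_x_sub_beta (E := E) hA hj
  have hτ0 := stFun_simpleRoot_x_sub_beta_nonneg E n j
  have e1 : ∀ u, stFun E n u - beta E n j = stFun E n u + (-1 : ℤ) • beta E n j := fun u => by
    module
  have hreflβ : ∀ i < n, -reflect (stMatrix E A n) (stFun E n α) (stFun E n φ) (beta E n i) =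
      stFun E n (c • α) + (-1 : ℤ) • beta E n i := fun i hi => by
    rw [reflect, pairing_stFun_beta E A hi, stFun_smul]; module
  have hreflτ : ∀ i < n, reflect (stMatrix E A n) (stFun E n α) (stFun E n φ)
      (stFun E n (simpleRoot E.x) - beta E n i) =
      stFun E n (simpleRoot E.x - c' • α) + (-1 : ℤ) • beta E n i := fun i hi => by
    rw [reflect, pairing_sub_right, pairing_stFun_beta E A hi, pairing_stFun_stFun hA hE,
      stFun_sub, stFun_smul]
    module
  have rule₁ : y = E.x → (stFun E n (simpleRoot E.x) - beta E n j ∈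
      inv (stMatrix E A n) (stFun E n α) (stFun E n φ) ↔ 0 < c') := fun hyx => by
    rw [IsStretchInversion.mem_inv_iff hA hE hα h0 hy (Or.inr ⟨hyx, j, hj, Or.inr rfl⟩) hτ hτ0,
      pairing_sub_right, pairing_stFun_beta E A hj, pairing_stFun_stFun hA hE]
  have rule₂ : y = E.x → (stFun E n (c • α) - beta E n j ∈
      inv (stMatrix E A n) (stFun E n α) (stFun E n φ) ↔ 0 < c) := fun hyx => by
    rw [e1, ← hreflβ j hj, hn.neg_reflect_mem_inv_iff hst,
      IsStretchInversion.mem_inv_iff hA hE hα h0 hy (Or.inr ⟨hyx, j, hj, Or.inl rfl⟩) hβ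
        (beta_nonneg E n j), pairing_stFun_beta E A hj]
  have rule₃ : stFun E n 0 - beta E n j ∉
      inv (stMatrix E A n) (stFun E n α) (stFun E n φ) := by
    rw [stFun_zero, zero_sub]; exact hn.neg_notMem_inv hβ (beta_nonneg E n j)
  have rule₄ : stFun E n (simpleRoot E.x - c' • α) - beta E n j ∉
      inv (stMatrix E A n) (stFun E n α) (stFun E n φ) := by
    rw [e1, ← hreflτ j hj]; exact hn.reflect_notMem_inv hst hτ hτ0
  have rule₅ : ¬ exc g → (stFun E n g - beta E n j ∈
      inv (stMatrix E A n) (stFun E n α) (stFun E n φ) ↔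
      simpleReflection A y g + leftPairing E A (simpleRoot y) • simpleRoot y ∈ K) := by
    intro hexc
    rcases mem_inv_stFun hA hE hα y n (stFun E n g - beta E n j) with h | ⟨ν, -, -, hνs, h⟩
    · rw [h, ← hK n j hj, e1, e1, reflect_stFun_add_smul_beta hA hE hj,
        ← simpleReflection_eq_reflect]
      have : simpleReflection A y g - (-1 * leftPairing E A (simpleRoot y)) • simpleRoot y =
        simpleReflection A y g + leftPairing E A (simpleRoot y) • simpleRoot y := by module
      rw [this]
    · exfalso
      rw [e1] at h
      rcases hνs with rfl | ⟨rfl, i, hi, hνi⟩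
      · obtain ⟨u, hu⟩ : ∃ u, stFun E n g + (-1 : ℤ) • beta E n j = stFun E n u := by
          rw [← stFun_reflect hA hE, ← stFun_neg, ← stFun_neg] at h
          rcases h with h | h | h | h <;> exact ⟨_, h⟩
        rw [← add_zero (stFun E n u), ← zero_smul ℤ (beta E n j)] at hu
        have := (stFun_add_smul_beta_inj hj hj hu).2.1
        omega
      · rcases hνi with rfl | rfl
        · have e2 : beta E n i = stFun E n 0 + (1 : ℤ) • beta E n i := by rw [stFun_zero]; module
          have e3 : -beta E n i = stFun E n 0 + (-1 : ℤ) • beta E n i := by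
            rw [stFun_zero]; module
          have e4 : reflect (stMatrix E A n) (stFun E n α) (stFun E n φ) (beta E n i) =
              stFun E n (-(c • α)) + (1 : ℤ) • beta E n i := by
            rw [← neg_neg (reflect _ _ _ _), hreflβ i hi, stFun_neg]; module
          rcases h with h | h | h | h
          · rw [e2] at h
            have := (stFun_add_smul_beta_inj hj hi h).2.1
            omega
          · rw [e3] at h
            exact hexc ⟨rfl, Or.inr (Or.inl (stFun_add_smul_beta_inj hj hi h).1)⟩
          · rw [e4] at h
            have := (stFun_add_smul_beta_inj hj hi h).2.1
            omega
          · rw [hreflβ i hi] at h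
            exact hexc ⟨rfl, Or.inr (Or.inr (Or.inr (stFun_add_smul_beta_inj hj hi h).1))⟩
        · have e2 : stFun E n (simpleRoot E.x) - beta E n i =
              stFun E n (simpleRoot E.x) + (-1 : ℤ) • beta E n i := by module
          have e3 : -(stFun E n (simpleRoot E.x) - beta E n i) =
              stFun E n (-simpleRoot E.x) + (1 : ℤ) • beta E n i := by rw [stFun_neg]; module
          have e4 : -reflect (stMatrix E A n) (stFun E n α) (stFun E n φ)
              (stFun E n (simpleRoot E.x) - beta E n i) =
              stFun E n (-(simpleRoot E.x - c' • α)) + (1 : ℤ) • beta E n i := by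
            rw [hreflτ i hi, stFun_neg]; module
          rcases h with h | h | h | h
          · rw [e2] at h
            exact hexc ⟨rfl, Or.inl (stFun_add_smul_beta_inj hj hi h).1⟩
          · rw [e3] at h
            have := (stFun_add_smul_beta_inj hj hi h).2.1
            omega
          · rw [hreflτ i hi] at h
            exact hexc ⟨rfl, Or.inr (Or.inr (Or.inl (stFun_add_smul_beta_inj hj hi h).1))⟩
          · rw [e4] at h
            have := (stFun_add_smul_beta_inj hj hi h).2.1
            omega
  constructor
  · intro h
    by_cases hexc : exc g
    · obtain ⟨hyx, rfl | rfl | rfl | rfl⟩ := hexc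
      · exact Or.inl ⟨hyx, rfl, (rule₁ hyx).1 h⟩
      · exact absurd h rule₃
      · exact absurd h rule₄
      · exact Or.inr (Or.inl ⟨hyx, rfl, (rule₂ hyx).1 h⟩)
    · exact Or.inr (Or.inr ⟨hexc, (rule₅ hexc).1 h⟩)
  · rintro (⟨hyx, rfl, h⟩ | ⟨hyx, rfl, h⟩ | ⟨hexc, h⟩)
    · exact (rule₁ hyx).2 h
    · exact (rule₂ hyx).2 h
    · exact (rule₅ hexc).2 h

theorem isUniform {E : ElasticData M} {A : Matrix B B ℤ} (hA : IsGCM A)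
    (hE : E.Compatible A) {α φ : B → ℤ} (hα : IsBiroot A α φ) (h0 : 0 ≤ α) :
    IsUniform E A α φ := by
  refine hA.descent_induction (P := fun α φ => IsUniform E A α φ) (isUniform_simpleRoot hA)
    (fun α φ y hα h0 hy _ _ ih => ⟨fun n γ hγ => ?_, fun n => stFun_mem_inv_iff_of_step hA hE hα
      h0 hy n (ih.stFun_mem n), exists_set_of_step hA hE hα h0 hy ih.exists_set⟩) hα h0
  rcases mem_inv_stFun hA hE hα y n γ with h | ⟨ν, -, -, hνs, h⟩
  · have := (ih.isPathVector n _ (h.1 hγ)).reflect hA hE (simpleRoot y) (simpleRoot y)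
    rwa [reflect_reflect ((isGCM_stMatrix E hA n).pairing_self
      (isBiroot_stFun_simpleRoot E A n y))] at this
  · have hν := hνs.isPathVector
    rcases h with rfl | rfl | rfl | rfl
    · exact hν
    · exact hν.neg
    · exact hν.reflect hA hE α φ
    · exact (hν.reflect hA hE α φ).neg

end Uniformity

/-! ### Counting inversions, formal combinations and the final description. -/

section Assembly

variable {B : Type*} [Fintype B] [DecidableEq B] {M : CoxeterMatrix B}

/-- The inversions of the stretches of `α`, described by the inversions of `α` and a finite set. -/
theorem exists_finset_mem_inv_iff {E : ElasticData M} {A : Matrix B B ℤ} (hA : IsGCM A)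
    (hE : E.Compatible A) {α φ : B → ℤ} (hα : IsBiroot A α φ) (h0 : 0 ≤ α) :
    ∃ G : Finset (B → ℤ), ∀ n γ,
      γ ∈ inv (stMatrix E A n) (stFun E n α) (stFun E n φ) ↔
        (∃ f ∈ inv A α φ, γ = stFun E n f) ∨
        ∃ g ∈ G, ∃ j < n, γ = stFun E n g - beta E n j ∨
          γ = -reflect (stMatrix E A n) (stFun E n α) (stFun E n φ)
            (stFun E n g - beta E n j) := by
  obtain ⟨hU1, hU2, K, hK⟩ := isUniform hA hE hα h0
  -- Since the set does not depend on `n`, it embeds in the finite inversion set of the smallest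
  -- stretch with a jump position, `n = 1` and `j = 0`.
  have hKfin : K.Finite := by
    have hfin := (isGCM_stMatrix E hA 1).inv_finite (isBiroot_stFun hA hE 1 hα)
    refine (hfin.preimage (f := fun g => stFun E 1 g - beta E 1 0) fun u _ v _ h => ?_).subset
      fun g hg => (hK 1 0 one_pos g).2 hg
    exact stFun_injective E 1 (sub_left_injective h)
  refine ⟨hKfin.toFinset, fun n γ => ?_⟩
  have hn := isGCM_stMatrix E hA n
  have hst := isBiroot_stFun hA hE n hα
  simp only [Set.Finite.mem_toFinset]
  constructor
  · intro hγ
    obtain ⟨f, rfl | ⟨j, hj, rfl | rfl⟩⟩ := hU1 n γ hγ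
    · exact Or.inl ⟨f, (hU2 n f).1 hγ, rfl⟩
    · right
      have e : -reflect (stMatrix E A n) (stFun E n α) (stFun E n φ)
          (stFun E n f + beta E n j) =
          stFun E n (-(reflect A α φ f - (1 * leftPairing E A φ) • α)) - beta E n j := by
        have := reflect_stFun_add_smul_beta hA hE hj α φ f 1
        rw [one_smul] at this
        rw [this, stFun_neg]
        module
      have hι := hn.neg_reflect_mem_inv hst hγ
      rw [e] at hι
      refine ⟨_, (hK n j hj _).1 hι, j, hj, Or.inr ?_⟩
      rw [← e, reflect_neg, reflect_reflect (hn.pairing_self hst), neg_neg]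
    · exact Or.inr ⟨f, (hK n j hj f).1 hγ, j, hj, Or.inl rfl⟩
  · rintro (⟨f, hf, rfl⟩ | ⟨g, hg, j, hj, rfl | rfl⟩)
    · exact (hU2 n f).2 hf
    · exact (hK n j hj g).2 hg
    · exact hn.neg_reflect_mem_inv hst ((hK n j hj g).2 hg)

/-- Jump `0`, `-1` and `+1` give three disjoint families, of sizes `|inv α|`, `|G| n` and `|G| n`;
the involution matches the last two. -/
theorem ncard_inv_stFun {E : ElasticData M} {A : Matrix B B ℤ} (hA : IsGCM A)
    (hE : E.Compatible A) {α φ : B → ℤ} (hα : IsBiroot A α φ) {G : Finset (B → ℤ)} {n : ℕ}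
    (hG : ∀ γ, γ ∈ inv (stMatrix E A n) (stFun E n α) (stFun E n φ) ↔
        (∃ f ∈ inv A α φ, γ = stFun E n f) ∨
        ∃ g ∈ G, ∃ j < n, γ = stFun E n g - beta E n j ∨
          γ = -reflect (stMatrix E A n) (stFun E n α) (stFun E n φ)
            (stFun E n g - beta E n j)) :
    (inv (stMatrix E A n) (stFun E n α) (stFun E n φ)).ncard =
      (inv A α φ).ncard + 2 * (G.card * n) := by
  have hn := isGCM_stMatrix E hA n
  have hst := isBiroot_stFun hA hE n hα
  have hrr := reflect_reflect (hn.pairing_self hst)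
  set ι : (StVertex E n → ℤ) → StVertex E n → ℤ := fun γ =>
    -reflect (stMatrix E A n) (stFun E n α) (stFun E n φ) γ with hι
  have hιinj : Function.Injective ι := fun u v h => by
    have := congrArg (reflect (stMatrix E A n) (stFun E n α) (stFun E n φ)) (neg_injective h)
    rwa [hrr, hrr] at this
  set m : (B → ℤ) × ℕ → StVertex E n → ℤ := fun p => stFun E n p.1 - beta E n p.2 with hm
  set S : Set ((B → ℤ) × ℕ) := ↑(G ×ˢ Finset.range n) with hS
  have hSmem : ∀ p, p ∈ S ↔ p.1 ∈ G ∧ p.2 < n := fun p => by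
    rw [hS, Finset.mem_coe, Finset.mem_product, Finset.mem_range]
  have hm1 : ∀ p, m p = stFun E n p.1 + (-1 : ℤ) • beta E n p.2 := fun p => by
    simp only [hm]; module
  have hιm : ∀ p ∈ S, ∃ u, ι (m p) = stFun E n u + (1 : ℤ) • beta E n p.2 := fun p hp => by
    refine ⟨-(reflect A α φ p.1 - (-1 * leftPairing E A φ) • α), ?_⟩
    simp only [hι]
    rw [hm1, reflect_stFun_add_smul_beta hA hE ((hSmem p).1 hp).2, stFun_neg]
    module
  have hst0 : ∀ f j, stFun E n f = stFun E n f + (0 : ℤ) • beta E n j := fun f j => by simp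
  have hminj : Set.InjOn m S := fun p hp q hq h => by
    rw [hm1, hm1] at h
    obtain ⟨h1, -, h3⟩ := stFun_add_smul_beta_inj ((hSmem p).1 hp).2 ((hSmem q).1 hq).2 h
    exact Prod.ext h1 (h3 (by norm_num))
  have hunion : inv (stMatrix E A n) (stFun E n α) (stFun E n φ) =
      stFun E n '' inv A α φ ∪ (m '' S ∪ ι '' (m '' S)) := by
    ext γ
    rw [hG γ]
    simp only [Set.mem_union, Set.mem_image, hSmem, Prod.exists]
    constructor
    · rintro (⟨f, hf, rfl⟩ | ⟨g, hg, j, hj, rfl | rfl⟩)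
      · exact Or.inl ⟨f, hf, rfl⟩
      · exact Or.inr (Or.inl ⟨g, j, ⟨hg, hj⟩, rfl⟩)
      · exact Or.inr (Or.inr ⟨_, ⟨g, j, ⟨hg, hj⟩, rfl⟩, rfl⟩)
    · rintro (⟨f, hf, rfl⟩ | ⟨g, j, ⟨hg, hj⟩, rfl⟩ | ⟨_, ⟨g, j, ⟨hg, hj⟩, rfl⟩, rfl⟩)
      · exact Or.inl ⟨f, hf, rfl⟩
      · exact Or.inr ⟨g, hg, j, hj, Or.inl rfl⟩
      · exact Or.inr ⟨g, hg, j, hj, Or.inr rfl⟩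
  have hd1 : Disjoint (m '' S) (ι '' (m '' S)) := by
    rw [Set.disjoint_left]
    rintro _ ⟨p, hp, rfl⟩ ⟨_, ⟨q, hq, rfl⟩, h⟩
    obtain ⟨u, hu⟩ := hιm q hq
    rw [hu, hm1] at h
    have := (stFun_add_smul_beta_inj ((hSmem q).1 hq).2 ((hSmem p).1 hp).2 h).2.1
    omega
  have hd2 : Disjoint (stFun E n '' inv A α φ) (m '' S ∪ ι '' (m '' S)) := by
    rw [Set.disjoint_left]
    rintro _ ⟨f, hf, rfl⟩ (⟨q, hq, h⟩ | ⟨_, ⟨q, hq, rfl⟩, h⟩)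
    · rw [hm1, hst0 f q.2] at h
      have := (stFun_add_smul_beta_inj ((hSmem q).1 hq).2 ((hSmem q).1 hq).2 h).2.1
      omega
    · obtain ⟨u, hu⟩ := hιm q hq
      rw [hu, hst0 f q.2] at h
      have := (stFun_add_smul_beta_inj ((hSmem q).1 hq).2 ((hSmem q).1 hq).2 h).2.1
      omega
  have hSfin : S.Finite := Finset.finite_toSet _
  have hScard : S.ncard = G.card * n := by
    rw [hS, Set.ncard_coe_finset, Finset.card_product, Finset.card_range]
  rw [hunion, Set.ncard_union_eq hd2 ((hA.inv_finite hα).image _)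
      ((hSfin.image _).union ((hSfin.image _).image _)),
    Set.ncard_union_eq hd1 (hSfin.image _) ((hSfin.image _).image _),
    Set.ncard_image_of_injective _ (stFun_injective E n), Set.ncard_image_of_injective _ hιinj,
    hminj.ncard_image, hScard, two_mul]

theorem betaPath_eq (E : ElasticData M) (n i : ℕ) : betaPath E n i = toReal (beta E n i) := by
  ext z
  rw [betaPath, Finset.sum_apply]
  rcases z with z | z
  · refine (Finset.sum_eq_zero fun j _ => ?_).trans (by simp [toReal, beta])
    split_ifs <;> simp [toReal, simpleRoot]
  · rw [Finset.sum_eq_single z]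
    · simp only [beta, toReal]
      split_ifs <;> simp [simpleRoot, toReal]
    · intro j _ hj
      split_ifs
      · simp [toReal, simpleRoot, hj.symm]
      · rfl
    · simp

/-- The formal linear combination standing for `st_n(v)`. -/
def stForm (E : ElasticData M) (r : ℕ) (v : B → ℤ) : Form E r
  | FormSymbol.off y => v y
  | FormSymbol.left _ => 0
  | FormSymbol.right k => if k = 0 then v E.x else 0

/-- The formal symbol standing for `β_{x_k}`. -/
def leftForm (E : ElasticData M) {r : ℕ} (k : Fin (r + 1)) : Form E r
  | FormSymbol.left k' => if k' = k then 1 else 0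
  | _ => 0

/-- The formal symbol standing for `β_{x_{n-k}}`. -/
def rightForm (E : ElasticData M) {r : ℕ} (k : Fin (r + 1)) : Form E r
  | FormSymbol.right k' => if k' = k then 1 else 0
  | _ => 0

theorem Form.eval_sub {E : ElasticData M} {r : ℕ} (c d : Form E r) (n : ℕ) :
    Form.eval (c - d) n = Form.eval c n - Form.eval d n := by
  simp only [Form.eval, Pi.sub_apply, sub_smul, Finset.sum_sub_distrib]
  abel

theorem eval_leftForm (E : ElasticData M) {r : ℕ} (k : Fin (r + 1)) (n : ℕ) :
    (leftForm E k).eval n = toReal (beta E n k) := by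
  simp [Form.eval, leftForm, ← betaPath_eq]

theorem eval_rightForm (E : ElasticData M) {r : ℕ} (k : Fin (r + 1)) (n : ℕ) :
    (rightForm E k).eval n = toReal (beta E n (n - k)) := by
  simp [Form.eval, rightForm, ← betaPath_eq]

/-- The part of `st_n(v)` on the path is `v(x) β_{x_n}`, the right symbol of index `0`. -/
theorem eval_stForm (E : ElasticData M) (r : ℕ) (v : B → ℤ) (n : ℕ) :
    (stForm E r v).eval n = toReal (stFun E n v) := by
  simp only [Form.eval, stForm, zero_smul, Finset.sum_const_zero, add_zero, ite_smul,
    Finset.sum_ite_eq', Finset.mem_univ, if_true, Fin.val_zero, tsub_zero,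
    betaPath_eq]
  ext z
  rcases z with z | z
  · simp only [Pi.add_apply, Finset.sum_apply, Pi.smul_apply, smul_eq_mul]
    rw [Finset.sum_eq_single z]
    · simp [betaOff, toReal, simpleRoot, beta, stFun]
    · intro y _ hy
      simp [betaOff, toReal, simpleRoot, hy.symm]
    · simp
  · simp only [Pi.add_apply, Finset.sum_apply, Pi.smul_apply, smul_eq_mul]
    rw [Finset.sum_eq_zero]
    · have := z.2
      simp [toReal, beta, stFun, Nat.lt_succ_iff.1 this]
    · intro y _
      simp [betaOff, toReal, simpleRoot]

theorem perp_neg_reflect_inf (A : Matrix B B ℤ) (α φ γ : B → ℤ) :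
    perp (toReal (-reflect A α φ γ)) ⊓ perp (toReal α) =
      perp (toReal γ) ⊓ perp (toReal α) := by
  rw [toReal_neg, perp_neg, toReal_reflect]
  ext χ
  simp only [Submodule.mem_inf, mem_perp, map_sub, map_smul, smul_eq_mul]
  constructor <;> rintro ⟨h1, h2⟩ <;> refine ⟨?_, h2⟩ <;> simpa [h2] using h1

theorem exists_fin_range {X : Type*} {S : Set X} (hS : S.Finite) :
    ∃ (s : ℕ) (f : Fin s → X), Set.range f = S := by
  refine ⟨_, fun i => (hS.toFinset.equivFin.symm i : X), ?_⟩
  ext x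
  simp only [Set.mem_range]
  constructor
  · rintro ⟨i, rfl⟩
    exact hS.mem_toFinset.1 (hS.toFinset.equivFin.symm i).2
  · intro hx
    exact ⟨hS.toFinset.equivFin ⟨x, hS.mem_toFinset.2 hx⟩, by simp⟩

/-- With `r = 1` the family `g - β_{x_j}` covers `2 ≤ j ≤ n - 2`, so the positions `j = 0, 1, n - 1`
go among the `f`. For `n ≥ 2` these are genuine jump positions, possibly repeated, so no spurious
hyperplane appears; partners under the involution add no new fracture. -/
theorem exists_fracturesGivenBy {E : ElasticData M} {A : Matrix B B ℤ} (hA : IsGCM A)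
    (hE : E.Compatible A) {α φ : B → ℤ} (hα : IsBiroot A α φ) (h0 : 0 ≤ α)
    {G : Finset (B → ℤ)}
    (hG : ∀ n γ, γ ∈ inv (stMatrix E A n) (stFun E n α) (stFun E n φ) ↔
        (∃ f ∈ inv A α φ, γ = stFun E n f) ∨
        ∃ g ∈ G, ∃ j < n, γ = stFun E n g - beta E n j ∨
          γ = -reflect (stMatrix E A n) (stFun E n α) (stFun E n φ)
            (stFun E n g - beta E n j)) :
    ∃ (s : ℕ) (f : Fin s → Form E 1) (g : Fin G.card → Form E 1),
      ∀ n, 2 ≤ n → FracturesGivenBy E A α f g n := by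
  have hSfin : (stForm E 1 '' inv A α φ ∪
      ((fun g => stForm E 1 g - leftForm E 0) '' (G : Set (B → ℤ)) ∪
        ((fun g => stForm E 1 g - leftForm E 1) '' (G : Set (B → ℤ)) ∪
          (fun g => stForm E 1 g - rightForm E 1) '' (G : Set (B → ℤ))))).Finite :=
    ((hA.inv_finite hα).image _).union ((G.finite_toSet.image _).union
      ((G.finite_toSet.image _).union (G.finite_toSet.image _)))
  obtain ⟨s, f, hf⟩ := exists_fin_range hSfin
  refine ⟨s, f, fun i => stForm E 1 (G.equivFin.symm i : B → ℤ), fun n hn2 => ?_⟩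
  rw [FracturesGivenBy, (isGCM_stMatrix E hA n).fractures_eq (isBiroot_stFun hA hE n hα)
    (stFun_nonneg E n h0)]
  have hminus : ∀ g ∈ G, ∀ j < n, stFun E n g - beta E n j ∈
      inv (stMatrix E A n) (stFun E n α) (stFun E n φ) := fun g hg j hj =>
    (hG n _).2 (Or.inr ⟨g, hg, j, hj, Or.inl rfl⟩)
  ext F
  constructor
  · have hmem : ∀ g ∈ G, ∀ j < n, perp (toReal (stFun E n g - beta E n j)) ∈
        formArrangement E f (fun i => stForm E 1 (G.equivFin.symm i : B → ℤ)) n := by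
      intro g hg j hj
      have hsp : ∀ c : Form E 1, c ∈ Set.range f →
          toReal (stFun E n g - beta E n j) = c.eval n →
          perp (toReal (stFun E n g - beta E n j)) ∈
            formArrangement E f (fun i => stForm E 1 (G.equivFin.symm i : B → ℤ)) n := by
        rintro _ ⟨i, rfl⟩ h
        exact Or.inl ⟨i, by rw [h]⟩
      by_cases h0 : j = 0
      · refine hsp (stForm E 1 g - leftForm E 0) (hf ▸ Or.inr (Or.inl ⟨g, hg, rfl⟩)) ?_
        rw [Form.eval_sub, eval_stForm, eval_leftForm, toReal_sub, h0]; rfl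
      by_cases h1 : j = 1
      · refine hsp (stForm E 1 g - leftForm E 1)
          (hf ▸ Or.inr (Or.inr (Or.inl ⟨g, hg, rfl⟩))) ?_
        rw [Form.eval_sub, eval_stForm, eval_leftForm, toReal_sub, h1]; rfl
      by_cases hl : j = n - 1
      · refine hsp (stForm E 1 g - rightForm E 1)
          (hf ▸ Or.inr (Or.inr (Or.inr ⟨g, hg, rfl⟩))) ?_
        rw [Form.eval_sub, eval_stForm, eval_rightForm, toReal_sub, hl]; rfl
      · refine Or.inr ⟨G.equivFin ⟨g, hg⟩, j, by omega, by omega, ?_⟩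
        beta_reduce
        rw [Equiv.symm_apply_apply, eval_stForm, betaPath_eq, toReal_sub]
    rintro ⟨γ, hγ, rfl⟩
    rcases (hG n γ).1 hγ with ⟨u, hu, rfl⟩ | ⟨g, hg, j, hj, rfl | rfl⟩
    · refine ⟨_, Or.inl ?_, rfl⟩
      obtain ⟨i, hi⟩ : stForm E 1 u ∈ Set.range f := hf ▸ Or.inl ⟨u, hu, rfl⟩
      exact ⟨i, by rw [hi, eval_stForm]⟩
    · exact ⟨_, hmem g hg j hj, rfl⟩
    · exact ⟨_, hmem g hg j hj, perp_neg_reflect_inf _ _ _ _⟩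
  · rintro ⟨H, ⟨i, rfl⟩ | ⟨i, j, hj1, hj2, rfl⟩, rfl⟩
    · have hi : f i ∈ Set.range f := ⟨i, rfl⟩
      rw [hf] at hi
      rcases hi with ⟨u, hu, hi⟩ | ⟨g, hg, hi⟩ | ⟨g, hg, hi⟩ | ⟨g, hg, hi⟩
      · exact ⟨stFun E n u, (hG n _).2 (Or.inl ⟨u, hu, rfl⟩), by rw [← hi, eval_stForm]⟩
      · refine ⟨_, hminus g hg 0 (by omega), ?_⟩
        simp only [← hi]
        rw [Form.eval_sub, eval_stForm, eval_leftForm, toReal_sub]; rfl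
      · refine ⟨_, hminus g hg 1 (by omega), ?_⟩
        simp only [← hi]
        rw [Form.eval_sub, eval_stForm, eval_leftForm, toReal_sub]; rfl
      · refine ⟨_, hminus g hg (n - 1) (by omega), ?_⟩
        simp only [← hi]
        rw [Form.eval_sub, eval_stForm, eval_rightForm, toReal_sub]; rfl
    · refine ⟨_, hminus _ (G.equivFin.symm i).2 j (by omega), ?_⟩
      rw [eval_stForm, betaPath_eq, toReal_sub]

/-- A zero entry forces `M i j = 2`: for infinite order the product of the entries is at least `4`,
and for finite order at least `3` it is `4 cos² (π / m) > 0`. -/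
theorem IsCartanMatrix.isGCM {A : Matrix B B ℤ} (hA : IsCartanMatrix M A) : IsGCM A := by
  refine ⟨hA.diag, hA.nonpos, fun i j h => ?_⟩
  have hij : i ≠ j := by
    rintro rfl
    rw [hA.diag] at h
    omega
  have h1 : M i j ≠ 1 := M.off_diagonal i j hij
  by_cases h2 : M i j = 2
  · exact hA.commuting j i (by rw [M.symmetric, h2])
  by_cases h3 : M i j = 0
  · have := hA.infinite i j h3
    simp [h] at this
  · exfalso
    have hm : 3 ≤ M i j := by omega
    have := hA.finite i j hm
    rw [h, Int.cast_zero, zero_mul] at this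
    have hm' : (3 : ℝ) ≤ M i j := by exact_mod_cast hm
    have hcos : 0 < Real.cos (Real.pi / (M i j : ℝ)) := by
      apply Real.cos_pos_of_mem_Ioo
      constructor
      · have : 0 < Real.pi / (M i j : ℝ) := by positivity
        linarith [Real.pi_pos]
      · apply div_lt_div_of_pos_left Real.pi_pos <;> linarith
    nlinarith [pow_pos hcos 2]

theorem IsCartanMatrix.compatible {A : Matrix B B ℤ} (hA : IsCartanMatrix M A)
    (E : ElasticData M) : E.Compatible A := by
  intro z hz hL hR
  have h : M E.x z = 2 := by
    by_contra h
    rcases (E.mem_iff z).2 ⟨hz, h⟩ with h | h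
    · exact hL h
    · exact hR h
  exact ⟨hA.commuting _ _ h, hA.commuting _ _ (by rw [M.symmetric, h])⟩

end Assembly
end Stretch

theorem mainTheorem3 {B : Type*} [Fintype B] [DecidableEq B] (M : CoxeterMatrix B)
    (A : Matrix B B ℤ) (hA : Stretch.IsCartanMatrix M A) (E : Stretch.ElasticData M)
    (α : B → ℤ) (hα : Stretch.IsPositiveRoot A α) :
    ∃ t : ℕ, Stretch.IsDepthGrowthRate E A α t ∧
      ((∃ (w : List B) (y₀ : B), Stretch.IsTypeOneExpr E A α w y₀) →
        ∃ (r s : ℕ) (f : Fin s → Stretch.Form E r) (g : Fin t → Stretch.Form E r),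
          ∀ n : ℕ, 2 * r ≤ n → Stretch.FracturesGivenBy E A α f g n) ∧
      (∃ (r s : ℕ) (f : Fin s → Stretch.Form E r) (g : Fin t → Stretch.Form E r),
          ∀ᶠ n : ℕ in Filter.atTop, Stretch.FracturesGivenBy E A α f g n) := by
  have hG := hA.isGCM
  have hE := hA.compatible E
  obtain ⟨hroot, h0⟩ := hα
  obtain ⟨φ, hα⟩ := hroot.exists_isBiroot
  obtain ⟨G, hinv⟩ := Stretch.exists_finset_mem_inv_iff hG hE hα h0
  obtain ⟨s, f, g, hfr⟩ := Stretch.exists_fracturesGivenBy hG hE hα h0 hinv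
  -- The forms with `r = 1` serve both fracture statements, the bound `n ≥ 2` being `n ≥ 2 r`. The
  -- depth formula follows by halving the two inversion counts.
  refine ⟨G.card, fun n => ?_, fun _ => ⟨1, s, f, g, fun n hn => hfr n hn⟩, 1, s, f, g,
    Filter.eventually_atTop.2 ⟨2, hfr⟩⟩
  have h1 := hG.ncard_inv_add_two hα h0
  have h2 := (Stretch.isGCM_stMatrix E hG n).ncard_inv_add_two
    (Stretch.isBiroot_stFun hG hE n hα) (Stretch.stFun_nonneg E n h0)
  rw [Stretch.ncard_inv_stFun hG hE hα (hinv n)] at h2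
  omega
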